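/- Let $p$ be a prime, let $e,n\ge 1$, $r=2en$, $q=p^r$, let $s\ge 1$ be a divisor of $p^e+1$ (hence of $q-1$), and let $0\le h<s$, $m\ge 2$, $t\mid m$. Let $\gamma$ be a primitive element of $\mathbb F_{q^m}$, let $\gamma_t$ be the norm of $\gamma$ from $\mathbb F_{q^m}$ to $\mathbb F_{q^t}$, and let $g=\gamma_1$ be its norm to $\mathbb F_q$. For $a\in\mathbb F_q$ let $N_t$ be the number of $x\in\mathbb F_{q^t}$ with $\mathrm{Tr}_{\mathbb F_{q^m}/\mathbb F_q}(x)=a$ and $\mathrm{N}_{\mathbb F_{q^m}/\mathbb F_q}(x)\in g^h\langle g^s\rangle$. Put $d=\gcd(m/t,s)$, $l=\gcd(t,s/d)$, $u=s/(dl)$ and $t_0=(q^t-1)/(q-1)$, and assume that $p\nmid m/t$ and $d\mid h$. For a positive divisor $N$ of $p^e+1$ put $k_N=N/2$ if $p>2$ and both $nt$ and $(p^e+1)/N$ are odd, and $k_N=0$ otherwise. Let $i_0$ be the solution of $\frac{m}{dt}\,i_0\equiv\frac hd \pmod{s/d}$ with $0\le i_0<s/d$. If $a\neq 0$, put $a_0=-\frac{m}{ta}\in\mathbb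 F_q^*$, let $\operatorname{ind}a_0$ be an integer $\iota\ge 0$ with $\gamma_t^{\iota}=a_0$, and put $D=k_{s/d}-i_0-\operatorname{ind}a_0$; if moreover $l\mid D$, let $j_0$ be the solution of $\frac{t_0}{l}\,j_0\equiv\frac Dl\pmod u$ with $0\le j_0<u$. Theorem. If $a=0$, then $$N_t=\begin{cases}\frac ds\bigl(q^{t-1}-1+(-1)^{nt}(q-1)\sqrt{q^{t-2}}\bigr)&\text{if } l>1 \text{ and } i_0\not\equiv k_l \pmod l,\\[2pt] \frac ds\bigl(q^{t-1}-1-(-1)^{nt}(q-1)(l-1)\sqrt{q^{t-2}}\bigr)&\text{if } l=1, \text{ or } l>1 \text{ and } i_0\equiv k_l \pmod l.\end{cases}$$ If $a\ne 0$, then $$N_t=\begin{cases}\frac ds\bigl(q^{t-1}-(-1)^{nt}\sqrt{q^{t-2}}\bigr)&\text{if } l\nmid D,\\[2pt] \frac ds\bigl(q^{t-1}-(-1)^{nt}\bigl(((-1)^n\sqrt q-1)l+1\bigr)\sqrt{q^{t-2}}\bigr)&\text{if } l\mid D,\ u>1 \text{ and } j_0\not\equiv k_u\pmod u,\\[2pt]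 \frac ds\bigl(q^{t-1}-(-1)^{nt}\bigl(((-1)^{n-1}(u-1)\sqrt q-1)l+1\bigr)\sqrt{q^{t-2}}\bigr)&\text{if } l\mid D, \text{ and } u=1 \text{ or } (u>1 \text{ and } j_0\equiv k_u\pmod u).\end{cases}$$ In particular, $N_t=\frac ds(q^{t-1}-1)$ if $a=0$ and $l=1$, and $N_t=q^{t-1}$ if $a\ne0$ and $d=s$. -/

import Mathlib

/-- For a unit `γ` of a field `K ⊇ L`, its norm `Norm_{K/L}(γ)`, as a unit of `L`.
For `K = 𝔽_{q^m}` and `γ` a primitive element this is the primitive element `γ_t` of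
`L = 𝔽_{q^t}`, respectively `g` of `L = 𝔽_q`. -/
noncomputable def unitNorm (L : Type*) {K : Type*} [Field L] [Field K] [Algebra L K]
    (γ : Kˣ) : Lˣ :=
  Units.map (Algebra.norm L : K →* L) γ

/-- The set `S_t(a, s, h)` of the `x ∈ E` (`E = 𝔽_{q^t}`, an intermediate field of `K = 𝔽_{q^m}`
over `F = 𝔽_q`) with `Tr_{K/F}(x) = a` and `Norm_{K/F}(x) ∈ g^h ⟨g^s⟩`,
where `g = Norm_{K/F}(γ)`. -/
def traceNormSet {F K : Type*} [Field F] [Field K] [Algebra F K]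
    (E : IntermediateField F K) (γ : Kˣ) (a : F) (s h : ℕ) : Set E :=
  {x | Algebra.trace F K (x : K) = a ∧
    ∃ y ∈ Subgroup.zpowers (unitNorm F γ ^ s),
      Algebra.norm F (x : K) = ((unitNorm F γ ^ h * y : Fˣ) : F)}

/-- The number `k_N`, for a divisor `N` of `p^e + 1`: it is `N / 2` if `p > 2` and both `n t` and
`(p^e + 1) / N` are odd (then `N` is even), and `0` otherwise. -/
def kConst (p e n t N : ℕ) : ℕ :=
  if 2 < p ∧ ¬ 2 ∣ n * t ∧ ¬ 2 ∣ (p ^ e + 1) / N then N / 2 else 0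

/-! Write P = p^e, F = 𝔽_q, E = 𝔽_{q^t}, S = s/d = lu. For x in E the trace from K is m/t times the
trace from E, and the norm from K is the (m/t)-th power of the norm from E. Since p ∤ m/t and d ∣ h,
N_t counts the units x = γ_t^z of E with z ≡ i₀ (mod S) and trace b = a/(m/t)
(`ncard_traceNormSet`).

Detecting the trace by additive characters turns this count into a sum over c ∈ F* of ψ(-cb) times a
Gaussian period of order S of E (`card_mul_card_trace_eq`). As S divides P + 1 and |E| is an even
power of P, these periods are semiprimitive: they take one common value except on a single class,
given by k_S (`mul_gaussPeriod_of_dvd`).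

So only the c in the exceptional class need attention. As γ_1 = γ_t^{t₀} with gcd(t₀, S) = l, that
class meets F* in nothing or in one class modulo u (`index_map_eq_iff`, `dvd_of_index_map_eq`). For
a = 0 it remains to count this class; for a ≠ 0, rescaling c leaves a Gaussian period of order u
over F, again semiprimitive.

The semiprimitive values come from the case N = P + 1. There 1 + Nη is the sum of ψ(c x^{P+1}). Off
one class the underlying form is nondegenerate, so the absolute value is √|E|; η is a rational
integer, and the congruence modulo P + 1 fixes the sign (`eq_of_sq_eq_of_modEq_one`). The last class
follows because all periods add up to -1. -/

section CyclicIndex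

/-! ### Discrete logarithm modulo N on a cyclic group. -/

variable {G : Type*} [CommGroup G] {γ : G} {N : ℕ} {f : G →* Multiplicative (ZMod N)}

theorem exists_index [Finite G] (hγ : ∀ x : G, x ∈ Subgroup.zpowers γ) (hN : N ∣ Nat.card G) :
    ∃ f : G →* Multiplicative (ZMod N), f γ = Multiplicative.ofAdd 1 := by
  refine ⟨monoidHomOfForallMemZpowers (g := γ) (g' := Multiplicative.ofAdd (1 : ZMod N)) hγ ?_, ?_⟩
  · rw [orderOf_ofAdd_eq_addOrderOf, ZMod.addOrderOf_one, orderOf_eq_card_of_forall_mem_zpowers hγ]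
    exact hN
  · exact monoidHomOfForallMemZpowers_apply_gen ..

theorem index_zpow (hf : f γ = Multiplicative.ofAdd 1) (z : ℤ) :
    f (γ ^ z) = Multiplicative.ofAdd (z : ZMod N) := by
  rw [map_zpow, hf, ← ofAdd_zsmul]; simp

theorem index_pow (hf : f γ = Multiplicative.ofAdd 1) (z : ℕ) :
    f (γ ^ z) = Multiplicative.ofAdd (z : ZMod N) := by
  simpa using index_zpow hf z

theorem index_surjective (hf : f γ = Multiplicative.ofAdd 1) : Function.Surjective f := fun i => by
  obtain ⟨z, hz⟩ := ZMod.intCast_surjective (Multiplicative.toAdd i)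
  exact ⟨γ ^ z, by rw [index_zpow hf, hz, ofAdd_toAdd]⟩

theorem index_eq_one_iff (hγ : ∀ x : G, x ∈ Subgroup.zpowers γ)
    (hf : f γ = Multiplicative.ofAdd 1) (x : G) : f x = 1 ↔ ∃ w : G, w ^ N = x := by
  constructor
  · intro h
    obtain ⟨z, rfl⟩ := hγ x
    rw [index_zpow hf, ofAdd_eq_one, ZMod.intCast_zmod_eq_zero_iff_dvd] at h
    obtain ⟨v, rfl⟩ := h
    exact ⟨γ ^ v, by rw [← zpow_natCast, ← zpow_mul, mul_comm]⟩
  · rintro ⟨w, rfl⟩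
    rw [map_pow]
    apply Multiplicative.toAdd.injective
    simp

theorem index_ext (hγ : ∀ x : G, x ∈ Subgroup.zpowers γ) {H : Type*} [Group H] {f g : G →* H}
    (h : f γ = g γ) : f = g := by
  ext x
  obtain ⟨z, rfl⟩ := hγ x
  simp [h]

theorem card_index_fiber [Fintype G] [NeZero N] (hf : f γ = Multiplicative.ofAdd 1)
    (i : Multiplicative (ZMod N)) :
    N * (Finset.univ.filter fun x => f x = i).card = Fintype.card G := by
  classical
  have hs := index_surjective hf
  have h : ∀ j, (Finset.univ.filter fun x => f x = j).card
      = (Finset.univ.filter fun x => f x = i).card := fun j => by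
    exact MonoidHom.card_fiber_eq_of_mem_range f (hs j) (hs i)
  rw [← Finset.card_univ, Finset.card_eq_sum_card_fiberwise (s := (Finset.univ : Finset G))
    (f := f) (t := Finset.univ) (by simp), Finset.sum_congr rfl fun j _ => h j]
  simp [ZMod.card]

/-- The N-th power map is N-to-one onto the kernel of the index map. -/
theorem sum_comp_pow [Fintype G] [NeZero N] (hγ : ∀ x : G, x ∈ Subgroup.zpowers γ)
    (hf : f γ = Multiplicative.ofAdd 1) {R : Type*} [CommRing R] (F : G → R) :
    ∑ x, F (x ^ N) = N * ∑ x, if f x = 1 then F x else 0 := by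
  classical
  have hfib : ∀ y, (Finset.univ.filter fun x : G => x ^ N = y).card
      = if f y = 1 then (Finset.univ.filter fun x : G => x ^ N = 1).card else 0 := by
    intro y
    split_ifs with hy
    · exact MonoidHom.card_fiber_eq_of_mem_range (powMonoidHom N : G →* G)
        ((index_eq_one_iff hγ hf y).1 hy) ⟨1, by simp⟩
    · rw [Finset.card_eq_zero, Finset.filter_eq_empty_iff]
      exact fun x _ hx => hy ((index_eq_one_iff hγ hf y).2 ⟨x, hx⟩)
  -- The order of G is the number of N-th roots of 1 times |ker f|, and also N times |ker f|.
  have hκ : (Finset.univ.filter fun x : G => x ^ N = 1).card = N := by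
    have h1 : Fintype.card G = (Finset.univ.filter fun x : G => x ^ N = 1).card
        * (Finset.univ.filter fun x : G => f x = 1).card := by
      rw [← Finset.card_univ, Finset.card_eq_sum_card_fiberwise (f := fun x : G => x ^ N)
        (t := Finset.univ) (by simp), Finset.sum_congr rfl fun j _ => hfib j, ← Finset.sum_filter,
        Finset.sum_const, smul_eq_mul, mul_comm]
    have h2 := card_index_fiber hf 1
    rw [h1] at h2
    refine (Nat.eq_of_mul_eq_mul_right ?_ h2).symm
    exact Finset.card_pos.2 ⟨1, by simp⟩
  rw [← Finset.sum_fiberwise (s := Finset.univ) (g := fun x : G => x ^ N), Finset.mul_sum]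
  refine Finset.sum_congr rfl fun y _ => ?_
  rw [Finset.sum_congr rfl (g := fun _ => F y) (fun x hx => by rw [(Finset.mem_filter.1 hx).2]),
    Finset.sum_const, hfib, hκ]
  split_ifs <;> simp

end CyclicIndex

/-! ### Gaussian periods: integrality and relation to power sums. -/

section Periods

variable {L : Type*} [Field L] [Fintype Lˣ] {γ : Lˣ} {N : ℕ}

/-- The Gaussian period attached to the additive character `ψ` and the fibre of `f` over `i`. -/
noncomputable def gaussPeriod (ψ : AddChar L ℂ) (f : Lˣ →* Multiplicative (ZMod N))
    (i : Multiplicative (ZMod N)) : ℂ :=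
  ∑ x : Lˣ, if f x = i then ψ x else 0

theorem gaussPeriod_mul (ψ : AddChar L ℂ) (f : Lˣ →* Multiplicative (ZMod N))
    (i : Multiplicative (ZMod N)) (c : Lˣ) :
    ∑ x : Lˣ, (if f x = i then ψ (c * x) else 0) = gaussPeriod ψ f (i * f c) := by
  rw [gaussPeriod,
    ← Equiv.sum_comp (Equiv.mulLeft c) fun x : Lˣ => if f x = i * f c then ψ x else 0]
  refine Finset.sum_congr rfl fun x _ => ?_
  simp [mul_comm i]

theorem sum_Icc_pow_of_pow_eq_one {p : ℕ} (hp : p.Prime) {ζ : ℂ} (hζ : ζ ^ p = 1) :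
    ∑ a ∈ Finset.Ico 1 p, ζ ^ a = if ζ = 1 then (p : ℂ) - 1 else -1 := by
  have h : ∑ a ∈ Finset.range p, ζ ^ a = 1 + ∑ a ∈ Finset.Ico 1 p, ζ ^ a := by
    rw [Finset.range_eq_Ico, Finset.sum_eq_sum_Ico_succ_bot hp.pos]; simp
  split_ifs with h1
  · subst h1
    simp [Nat.cast_sub hp.one_le]
  · rw [geom_sum_eq h1, hζ, sub_self, zero_div] at h
    linear_combination -h

/-- A period over a set stable under the units of the prime field is a rational integer. -/
theorem exists_gaussPeriod_eq_intCast {p : ℕ} (hp : p.Prime) [CharP L p]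
    {f : Lˣ →* Multiplicative (ZMod N)}
    (hfp : ∀ (a : ℕ) (x : Lˣ), (x : L) = a → f x = 1) (ψ : AddChar L ℂ)
    (i : Multiplicative (ZMod N)) : ∃ z : ℤ, gaussPeriod ψ f i = z := by
  have hψp : ∀ x, ψ x ^ p = 1 := fun x => by
    rw [← AddChar.map_nsmul_eq_pow, nsmul_eq_mul, CharP.cast_eq_zero, zero_mul,
      AddChar.map_zero_eq_one]
  -- The period is a sum of roots of unity, hence an algebraic integer. Averaging over scalings by
  -- 1, …, p - 1 shows that it is rational, and ℤ is integrally closed.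
  have hint : IsIntegral ℤ (gaussPeriod ψ f i) := by
    refine IsIntegral.sum _ fun x _ => ?_
    split_ifs
    · exact IsIntegral.of_pow hp.pos (by rw [hψp]; exact isIntegral_one)
    · exact isIntegral_zero
  have hmul : ((p : ℂ) - 1) * gaussPeriod ψ f i
      = ∑ x : Lˣ, if f x = i then ∑ a ∈ Finset.Ico 1 p, ψ x ^ a else 0 := by
    have h1 : ∀ a ∈ Finset.Ico 1 p,
        ∑ x : Lˣ, (if f x = i then ψ x ^ a else 0) = gaussPeriod ψ f i := by
      intro a ha
      rw [Finset.mem_Ico] at ha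
      have ha0 : (a : L) ≠ 0 := by
        rw [Ne, CharP.cast_eq_zero_iff L p]
        exact Nat.not_dvd_of_pos_of_lt ha.1 ha.2
      have h2 := gaussPeriod_mul ψ f i (Units.mk0 (a : L) ha0)
      rw [hfp a (Units.mk0 (a : L) ha0) rfl, mul_one] at h2
      rw [← h2]
      refine Finset.sum_congr rfl fun x _ => ?_
      rw [← AddChar.map_nsmul_eq_pow, nsmul_eq_mul, Units.val_mk0]
    have h3 := Finset.sum_congr rfl h1
    rw [Finset.sum_const, Nat.card_Ico, Finset.sum_comm, nsmul_eq_mul,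
      Nat.cast_sub hp.one_le, Nat.cast_one] at h3
    rw [← h3]
    refine Finset.sum_congr rfl fun x _ => ?_
    split_ifs <;> simp
  obtain ⟨w, hw⟩ : ∃ w : ℤ, ((p : ℂ) - 1) * gaussPeriod ψ f i = w := by
    refine ⟨∑ x : Lˣ, if f x = i then (if ψ x = 1 then (p : ℤ) - 1 else -1) else 0, ?_⟩
    rw [hmul]
    push_cast
    refine Finset.sum_congr rfl fun x _ => ?_
    rw [sum_Icc_pow_of_pow_eq_one hp (hψp x)]
  have hp1 : (p : ℂ) - 1 ≠ 0 := sub_ne_zero.2 (by exact_mod_cast hp.one_lt.ne')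
  have hq : gaussPeriod ψ f i = algebraMap ℚ ℂ ((w : ℚ) / ((p : ℚ) - 1)) := by
    rw [eq_comm, map_div₀]
    simp only [map_intCast, map_sub, map_natCast, map_one]
    rw [div_eq_iff hp1, ← hw, mul_comm]
  rw [hq] at hint
  rw [isIntegral_algebraMap_iff (algebraMap ℚ ℂ).injective,
    IsIntegrallyClosed.isIntegral_iff] at hint
  obtain ⟨z, hz⟩ := hint
  exact ⟨z, by rw [hq, ← hz]; simp⟩

variable [Fintype L]

theorem sum_eq_zero_add_sum_units {R : Type*} [AddCommMonoid R] (F : L → R) :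
    ∑ x, F x = F 0 + ∑ x : Lˣ, F x := by
  classical
  rw [← Finset.add_sum_erase _ _ (Finset.mem_univ (0 : L))]
  congr 1
  refine (Finset.sum_bij (fun (x : Lˣ) _ => (x : L)) ?_ ?_ ?_ ?_).symm
  · simp
  · exact fun a _ b _ h => Units.ext h
  · exact fun b hb => ⟨Units.mk0 b (Finset.ne_of_mem_erase hb), by simp⟩
  · simp

theorem sum_units_addChar {ψ : AddChar L ℂ} (hψ : ψ ≠ 1) : ∑ x : Lˣ, ψ x = -1 := by
  have h := AddChar.sum_eq_zero_of_ne_one hψ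
  rw [sum_eq_zero_add_sum_units, AddChar.map_zero_eq_one] at h
  linear_combination h

theorem sum_gaussPeriod [NeZero N] {ψ : AddChar L ℂ} (hψ : ψ ≠ 1)
    (f : Lˣ →* Multiplicative (ZMod N)) : ∑ i, gaussPeriod ψ f i = -1 := by
  simp_rw [gaussPeriod]
  rw [Finset.sum_comm]
  simp [sum_units_addChar hψ]

theorem sum_mul_pow_eq [NeZero N] (hγ : ∀ x : Lˣ, x ∈ Subgroup.zpowers γ)
    {f : Lˣ →* Multiplicative (ZMod N)} (hf : f γ = Multiplicative.ofAdd 1)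
    (ψ : AddChar L ℂ) (c : Lˣ) :
    ∑ x : L, ψ (c * x ^ N) = 1 + N * gaussPeriod ψ f (f c) := by
  rw [sum_eq_zero_add_sum_units, zero_pow (NeZero.ne N), mul_zero, AddChar.map_zero_eq_one]
  have h := sum_comp_pow hγ hf fun x : Lˣ => ψ (c * x)
  push_cast at h
  rw [h, gaussPeriod_mul, one_mul]

end Periods

/-! ### Gaussian periods in the semiprimitive case. -/

section Semiprimitive

theorem pow_modEq_neg_one_pow (P k : ℕ) : ((P : ℤ) ^ k) ≡ (-1) ^ k [ZMOD (P + 1 : ℕ)] := by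
  refine Int.ModEq.pow k ?_
  rw [Int.modEq_iff_dvd]
  exact ⟨-1, by push_cast; ring⟩

/-- Since P ≡ -1, the wrong sign would give 2 ≡ 0 modulo P + 1 ≥ 3. -/
theorem eq_of_sq_eq_of_modEq_one {P k : ℕ} (hP : 2 ≤ P) {z : ℤ} (hz : z ^ 2 = (P : ℤ) ^ (2 * k))
    (h1 : z ≡ 1 [ZMOD (P + 1 : ℕ)]) : z = (-1) ^ k * (P : ℤ) ^ k := by
  have hs : ((-1 : ℤ) ^ k) * (-1) ^ k = 1 := by rw [← mul_pow]; simp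
  have hm : (-1) ^ k * (P : ℤ) ^ k ≡ 1 [ZMOD (P + 1 : ℕ)] := by
    have := (pow_modEq_neg_one_pow P k).mul_left ((-1) ^ k)
    rwa [hs] at this
  have hf : (z - (-1) ^ k * (P : ℤ) ^ k) * (z + (-1) ^ k * (P : ℤ) ^ k) = 0 := by
    have : ((-1) ^ k * (P : ℤ) ^ k) * ((-1) ^ k * (P : ℤ) ^ k) = (P : ℤ) ^ (2 * k) := by
      calc _ = ((-1 : ℤ) ^ k * (-1) ^ k) * ((P : ℤ) ^ k * (P : ℤ) ^ k) := by ring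
        _ = _ := by rw [hs]; ring
    linear_combination hz - this
  rcases mul_eq_zero.1 hf with h | h
  · linarith
  · exfalso
    have h2 := h1.add hm
    rw [h] at h2
    have h3 := h2.dvd
    norm_num at h3
    have := Int.le_of_dvd (by norm_num) h3
    omega

/-- `(P ^ (2 k) - 1) / (P ^ 2 - 1)` is congruent to `k` modulo `2` when `P` is odd. -/
theorem exists_pow_two_mul_eq (P k : ℕ) :
    ∃ M : ℕ, (P : ℤ) ^ (2 * k) - 1 = (P ^ 2 - 1) * M ∧ (Odd P → (Odd M ↔ Odd k)) := by
  refine ⟨∑ i ∈ Finset.range k, (P ^ 2) ^ i, ?_, fun hP => ?_⟩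
  · have := mul_geom_sum ((P : ℤ) ^ 2) k
    push_cast
    rw [this, pow_mul]
  · induction k with
    | zero => simp
    | succ k ih =>
      rw [Finset.sum_range_succ, Nat.odd_add, ih, Nat.odd_add]
      have : Odd ((P ^ 2) ^ k) := (hP.pow).pow
      simp [← Nat.not_odd_iff_even, this]

theorem card_units_int {L : Type*} [Field L] [Fintype L] {P k : ℕ} (hL : Fintype.card L = P ^ (2 * k)) :
    (Nat.card Lˣ : ℤ) = (P : ℤ) ^ (2 * k) - 1 := by
  have h : 1 ≤ Fintype.card L := Fintype.card_pos
  rw [Nat.card_units, Nat.card_eq_fintype_card, Nat.cast_sub h, hL]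
  push_cast; ring

variable {L : Type*} [Field L] [Fintype L] {γ : Lˣ} {p e k : ℕ}

/-- The exponent of w is a multiple of |L*|/(P - 1) = (P + 1)M. This applies to the units of the
prime field, whose triviality is needed for integrality of the periods. -/
theorem index_eq_one_of_pow_eq_one {P : ℕ} (hP : 2 ≤ P)
    (hL : Fintype.card L = P ^ (2 * k)) (hγ : ∀ x : Lˣ, x ∈ Subgroup.zpowers γ)
    {f : Lˣ →* Multiplicative (ZMod (P + 1))} (hf : f γ = Multiplicative.ofAdd 1)
    {w : Lˣ} (hw : w ^ (P - 1) = 1) : f w = 1 := by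
  obtain ⟨z, rfl⟩ := hγ w
  obtain ⟨M, hM, -⟩ := exists_pow_two_mul_eq P k
  have h1 : ((P : ℤ) - 1) ≠ 0 := by omega
  have hd : (Nat.card Lˣ : ℤ) ∣ z * (P - 1 : ℤ) := by
    rw [← orderOf_eq_card_of_forall_mem_zpowers hγ, orderOf_dvd_iff_zpow_eq_one, zpow_mul]
    have : ((P : ℤ) - 1) = (P - 1 : ℕ) := by omega
    rw [this, zpow_natCast]
    exact hw
  rw [card_units_int hL, hM] at hd
  have h2 : ((P + 1 : ℕ) : ℤ) ∣ z := by
    refine Int.dvd_of_mul_dvd_mul_right h1 (dvd_trans ⟨M, ?_⟩ hd)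
    push_cast; ring
  show f (γ ^ z) = 1
  rw [index_zpow hf, (ZMod.intCast_zmod_eq_zero_iff_dvd _ _).2 h2, ofAdd_zero]

/-- These w make the form c x^(P+1) degenerate, so their common index is the exceptional class. For
odd p the exponent z of w satisfies 2z = (P + 1)Mv with v odd, and M has the parity of k; for p = 2
one has -1 = 1. -/
theorem index_eq_of_pow_eq_neg_one (hp : p.Prime) [CharP L p] (he : 1 ≤ e)
    (hL : Fintype.card L = (p ^ e) ^ (2 * k)) (hγ : ∀ x : Lˣ, x ∈ Subgroup.zpowers γ)
    {f : Lˣ →* Multiplicative (ZMod (p ^ e + 1))} (hf : f γ = Multiplicative.ofAdd 1)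
    {w : Lˣ} (hw : w ^ (p ^ e - 1) = -1) :
    f w = Multiplicative.ofAdd
      (((if 2 < p ∧ Odd k then (p ^ e + 1) / 2 else 0 : ℕ) : ZMod (p ^ e + 1))) := by
  have hP : 2 ≤ p ^ e := hp.two_le.trans (Nat.le_self_pow (by omega) p)
  rcases hp.eq_two_or_odd' with rfl | hodd
  · have h11 : (-1 : Lˣ) = 1 := Units.ext (by simpa using CharTwo.neg_eq (1 : L))
    rw [index_eq_one_of_pow_eq_one hP hL hγ hf (hw.trans h11)]
    simp
  have hp2 : 2 < p := lt_of_le_of_ne hp.two_le (by rintro rfl; exact absurd hodd (by decide))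
  have hPo : Odd (p ^ e) := hodd.pow
  have h11 : (-1 : Lˣ) ≠ 1 := by
    intro h
    have h2 : (-1 : L) = 1 := by simpa using congrArg Units.val h
    have : ringChar L ≠ 2 := by rw [ringChar.eq L p]; omega
    exact Ring.neg_one_ne_one_of_char_ne_two this h2
  obtain ⟨z, rfl⟩ := hγ w
  obtain ⟨M, hM, hMk⟩ := exists_pow_two_mul_eq (p ^ e) k
  specialize hMk hPo
  generalize p ^ e = P at *
  have h1 : ((P : ℤ) - 1) ≠ 0 := by omega
  have hcast : ((P : ℤ) - 1) = (P - 1 : ℕ) := by omega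
  have hw' : (γ ^ z) ^ (P - 1) = -1 := hw
  have hdvd : ∀ v : ℤ, (γ ^ z) ^ (v * (P - 1 : ℤ)) = 1 ↔ ((P : ℤ) + 1) * M ∣ v * z := by
    intro v
    rw [← zpow_mul, ← orderOf_dvd_iff_zpow_eq_one, orderOf_eq_card_of_forall_mem_zpowers hγ,
      card_units_int hL, hM]
    rw [show ((P : ℤ) ^ 2 - 1) * M = (P - 1) * ((P + 1) * M) by ring,
      show z * (v * ((P : ℤ) - 1)) = (P - 1) * (v * z) by ring]
    exact mul_dvd_mul_iff_left h1
  have hA : ((P : ℤ) + 1) * M ∣ 2 * z := by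
    rw [← hdvd, hcast, mul_comm, zpow_mul, zpow_natCast, hw']
    exact neg_one_sq
  have hB : ¬ ((P : ℤ) + 1) * M ∣ z := by
    rw [← one_mul z, ← hdvd, hcast, one_mul, zpow_natCast, hw']
    exact h11
  obtain ⟨v, hv⟩ := hA
  have hvo : Odd v := by
    rw [← Int.not_even_iff_odd]
    rintro ⟨b, rfl⟩
    exact hB ⟨b, by linarith⟩
  obtain ⟨h, hh⟩ := hPo
  show f (γ ^ z) = _
  rw [index_zpow hf]
  congr 1
  rw [← Int.cast_natCast (R := ZMod (P + 1)), ZMod.intCast_eq_intCast_iff_dvd_sub]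
  by_cases hk : Odd k
  · obtain ⟨b, hb⟩ := hvo.mul (by exact_mod_cast hMk.2 hk : Odd (M : ℤ))
    rw [if_pos ⟨hp2, hk⟩]
    have h3 : (P + 1) / 2 = h + 1 := by omega
    rw [h3]
    refine ⟨-b, ?_⟩
    have : 2 * z = ((P : ℤ) + 1) * (2 * b + 1) := by rw [hv, ← hb]; ring
    have hh' : (P : ℤ) = 2 * h + 1 := by exact_mod_cast hh
    push_cast
    rw [hh'] at this ⊢
    linarith
  · obtain ⟨b, hb⟩ := (Nat.not_odd_iff_even.1 (mt hMk.1 hk))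
    rw [if_neg (by tauto)]
    refine ⟨-(b * v), ?_⟩
    rw [hb] at hv
    push_cast at hv ⊢
    linarith

/-- The absolute value of the character sum of the nondegenerate form `c x ^ (p ^ e + 1)`. -/
theorem sum_mul_pow_mul_conj (hp : p.Prime) [CharP L p]
    (hL : Fintype.card L = (p ^ e) ^ (2 * k)) {ψ : AddChar L ℂ} (hψ : ψ ≠ 1)
    (hψF : ∀ x, ψ (x ^ p) = ψ x) (c : Lˣ)
    (hc : ∀ w z : Lˣ, w = c * z ^ (p ^ e + 1) → w ^ (p ^ e - 1) ≠ -1) :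
    (∑ x : L, ψ (c * x ^ (p ^ e + 1))) * (starRingEnd ℂ) (∑ x : L, ψ (c * x ^ (p ^ e + 1)))
      = (p ^ e : ℕ) ^ (2 * k) := by
  have hψP : ∀ x, ψ (x ^ p ^ e) = ψ x := by
    intro x
    clear hL hc
    induction e with
    | zero => simp
    | succ e ih => rw [pow_succ, pow_mul, hψF, ih]
  have := Fact.mk hp
  have hfrob : Function.Bijective fun y : L => y ^ p ^ e := by
    have := (iterateFrobenius L p e).injective
    exact Finite.injective_iff_bijective.1 this
  have hP1 : 1 ≤ p ^ e := Nat.pow_pos hp.pos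
  have hinner : ∀ z : L, z ≠ 0 → ∑ y : L, ψ (c * (z ^ p ^ e * y + z * y ^ p ^ e)) = 0 := by
    intro z hz
    -- Frobenius invariance of ψ replaces the first term by its P-th power, so that both terms
    -- become multiples of y^P.
    have h1 : ∀ y : L, ψ (c * (z ^ p ^ e * y + z * y ^ p ^ e))
        = ψ (((c : L) ^ p ^ e * (z ^ p ^ e) ^ p ^ e + c * z) * y ^ p ^ e) := by
      intro y
      rw [mul_add, AddChar.map_add_eq_mul, ← hψP (c * (z ^ p ^ e * y)), mul_pow, mul_pow,
        ← AddChar.map_add_eq_mul]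
      congr 1
      ring
    simp_rw [h1]
    -- If this coefficient vanished, multiplying by z^P would give w^P = -w for w = c z^(P+1), which
    -- is excluded.
    have hne : (c : L) ^ p ^ e * (z ^ p ^ e) ^ p ^ e + c * z ≠ 0 := by
      intro h0
      refine hc (c * Units.mk0 z hz ^ (p ^ e + 1)) (Units.mk0 z hz) rfl ?_
      set w : Lˣ := c * Units.mk0 z hz ^ (p ^ e + 1) with hw
      have h2 : w ^ p ^ e = -w := by
        apply Units.ext
        rw [hw]
        push_cast
        rw [Units.val_mk0]
        linear_combination z ^ p ^ e * h0
      rw [← mul_left_inj w, ← pow_succ, Nat.sub_add_cancel hP1, h2, neg_one_mul]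
    rw [hfrob.sum_comp fun y => ψ (_ * y)]
    have := AddChar.sum_eq_zero_of_ne_one (ψ := AddChar.mulShift ψ _)
      (mt (AddChar.mulShift_unit_eq_one_iff ψ (isUnit_iff_ne_zero.2 hne)).1 hψ)
    simpa using this
  rw [map_sum, Finset.sum_mul_sum, Finset.sum_comm]
  -- Substituting x = z + y leaves the form at z and its polarization in (z, y); only z = 0 survives
  -- the sum over y.
  have hstep : ∀ y : L, ∑ x : L, ψ (c * x ^ (p ^ e + 1)) * (starRingEnd ℂ) (ψ (c * y ^ (p ^ e + 1)))
      = ∑ z : L, ψ (c * z ^ (p ^ e + 1)) * ψ (c * (z ^ p ^ e * y + z * y ^ p ^ e)) := by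
    intro y
    rw [← Equiv.sum_comp (Equiv.addRight y)]
    refine Finset.sum_congr rfl fun z _ => ?_
    rw [← AddChar.map_neg_eq_conj, ← AddChar.map_add_eq_mul, ← AddChar.map_add_eq_mul,
      Equiv.coe_addRight, pow_succ (z + y), add_pow_char_pow]
    congr 1
    ring
  simp_rw [hstep]
  rw [Finset.sum_comm]
  simp_rw [← Finset.mul_sum]
  rw [Finset.sum_eq_single 0 (fun z _ hz => by rw [hinner z hz, mul_zero]) (by simp)]
  have : p ^ e ≠ 0 := by omega
  simp [hL, zero_pow this]

variable [Fintype Lˣ]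

theorem succ_mul_gaussPeriod (hp : p.Prime) [CharP L p] (he : 1 ≤ e)
    (hL : Fintype.card L = (p ^ e) ^ (2 * k)) (hγ : ∀ x : Lˣ, x ∈ Subgroup.zpowers γ)
    {f : Lˣ →* Multiplicative (ZMod (p ^ e + 1))} (hf : f γ = Multiplicative.ofAdd 1)
    {ψ : AddChar L ℂ} (hψ : ψ ≠ 1) (hψF : ∀ x, ψ (x ^ p) = ψ x)
    (i : Multiplicative (ZMod (p ^ e + 1))) :
    ((p ^ e + 1 : ℕ) : ℂ) * gaussPeriod ψ f i = (-1) ^ k * (p ^ e : ℕ) ^ k - 1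
      - if i = Multiplicative.ofAdd
          (((if 2 < p ∧ Odd k then (p ^ e + 1) / 2 else 0 : ℕ) : ZMod (p ^ e + 1)))
        then ((p ^ e + 1 : ℕ) : ℂ) * ((-1) ^ k * (p ^ e : ℕ) ^ k) else 0 := by
  set κ := Multiplicative.ofAdd
          (((if 2 < p ∧ Odd k then (p ^ e + 1) / 2 else 0 : ℕ) : ZMod (p ^ e + 1))) with hκ
  have hP : 2 ≤ p ^ e := hp.two_le.trans (Nat.le_self_pow (by omega) p)
  have hne : ∀ i, i ≠ κ → ((p ^ e + 1 : ℕ) : ℂ) * gaussPeriod ψ f i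
      = (-1) ^ k * (p ^ e : ℕ) ^ k - 1 := by
    intro i hi
    obtain ⟨c, rfl⟩ := index_surjective hf i
    have hS := sum_mul_pow_mul_conj hp hL hψ hψF c fun w z hw hw1 => hi <| by
      rw [hκ, ← index_eq_of_pow_eq_neg_one hp he hL hγ hf hw1, hw, map_mul,
        (index_eq_one_iff hγ hf _).2 ⟨z, rfl⟩, mul_one]
    rw [sum_mul_pow_eq hγ hf] at hS
    -- Once the period is an integer, conjugation acts trivially and the squared absolute value is
    -- an ordinary square.
    obtain ⟨z, hz⟩ := exists_gaussPeriod_eq_intCast hp (f := f) (fun a x hx => by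
      refine index_eq_one_of_pow_eq_one hP hL hγ hf ?_
      obtain ⟨b, hb⟩ : p - 1 ∣ p ^ e - 1 := by
        simpa using Nat.sub_dvd_pow_sub_pow p 1 e
      have ha : x ^ (p - 1) = 1 := by
        have := Fact.mk hp
        apply Units.ext
        have h1 : (x : L) ^ p = x := by
          rw [hx, ← frobenius_def, map_natCast]
        rw [← mul_left_inj' x.ne_zero, Units.val_pow_eq_pow_val, ← pow_succ,
          Nat.sub_add_cancel hp.one_le, h1]
        simp
      rw [hb, pow_mul, ha, one_pow]) ψ (f c)
    rw [hz] at hS ⊢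
    have hcast : (1 : ℂ) + ((p ^ e + 1 : ℕ) : ℂ) * z
        = ((1 + ((p ^ e + 1 : ℕ) : ℤ) * z : ℤ) : ℂ) := by
      push_cast; ring
    rw [hcast, map_intCast] at hS
    have hS' : (1 + ((p ^ e + 1 : ℕ) : ℤ) * z) ^ 2 = ((p ^ e : ℕ) : ℤ) ^ (2 * k) := by
      rw [sq]; exact_mod_cast hS
    have h1 := eq_of_sq_eq_of_modEq_one hP hS' (by
      rw [Int.modEq_iff_dvd]; exact ⟨-z, by ring⟩)
    rw [h1] at hcast
    push_cast at hcast ⊢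
    linear_combination hcast
  split_ifs with hi
  -- The exceptional period is -1 minus the P others, all known.
  · subst hi
    have h := sum_gaussPeriod hψ f
    rw [← Finset.add_sum_erase _ _ (Finset.mem_univ κ)] at h
    have h2 : ((p ^ e + 1 : ℕ) : ℂ) * ∑ j ∈ Finset.univ.erase κ, gaussPeriod ψ f j
        = ((p ^ e : ℕ) : ℂ) * ((-1) ^ k * (p ^ e : ℕ) ^ k - 1) := by
      rw [Finset.mul_sum, Finset.sum_congr rfl fun j hj => hne j (Finset.ne_of_mem_erase hj),
        Finset.sum_const, Finset.card_erase_of_mem (Finset.mem_univ _), nsmul_eq_mul]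
      congr 2
      simp [ZMod.card]
    have h3 := congrArg (fun x => ((p ^ e + 1 : ℕ) : ℂ) * x) h
    simp only [mul_add, h2] at h3
    push_cast at h3 ⊢
    linear_combination h3
  · rw [hne i hi, sub_zero]

/-- With P + 1 = NT, half of it is N(T/2) ≡ 0 for T even; for p and T odd, N is even and the half is
≡ N/2 modulo N. -/
theorem cast_shift_eq_kConst {p e n t N : ℕ} (hp : p.Prime) (hN : N ∣ p ^ e + 1) :
    ((if 2 < p ∧ Odd (n * t) then (p ^ e + 1) / 2 else 0 : ℕ) : ZMod N) = kConst p e n t N := by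
  unfold kConst
  simp_rw [← even_iff_two_dvd, Nat.not_even_iff_odd]
  by_cases h : 2 < p ∧ Odd (n * t)
  · rw [if_pos h]
    obtain ⟨T, hT⟩ := hN
    have hpos : 0 < N := Nat.pos_of_ne_zero (by rintro rfl; simp at hT)
    rw [hT, Nat.mul_div_cancel_left _ hpos]
    rcases Nat.even_or_odd T with ⟨b, hb⟩ | ⟨b, hb⟩
    · rw [if_neg (by simp [hb, ← two_mul]), hb, ← two_mul, mul_left_comm,
        Nat.mul_div_cancel_left _ two_pos]
      simp
    · rw [if_pos ⟨h.1, h.2, hb ▸ odd_two_mul_add_one b⟩]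
      have hN2 : Even N := by
        by_contra hN2
        rw [Nat.not_even_iff_odd] at hN2
        have h1 : Odd (N * T) := hN2.mul ⟨b, hb⟩
        rw [← hT] at h1
        have hpo : Odd p := hp.odd_of_ne_two h.1.ne'
        exact (Nat.not_odd_iff_even.2 (hpo.pow.add_one)) h1
      obtain ⟨a, ha⟩ := hN2
      have : N * T / 2 = N * b + N / 2 := by
        rw [ha, hb, ← two_mul, mul_assoc, Nat.mul_div_cancel_left _ two_pos,
          Nat.mul_div_cancel_left _ two_pos]
        ring
      rw [this]; simp
  · rw [if_neg h, if_neg (by tauto)]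

/-- Gaussian periods in the semiprimitive case. -/
theorem mul_gaussPeriod_of_dvd (hp : p.Prime) [CharP L p] (he : 1 ≤ e) {n t : ℕ}
    (hL : Fintype.card L = (p ^ e) ^ (2 * (n * t))) (hγ : ∀ x : Lˣ, x ∈ Subgroup.zpowers γ)
    {N : ℕ} (hN : N ∣ p ^ e + 1)
    {f : Lˣ →* Multiplicative (ZMod N)} (hf : f γ = Multiplicative.ofAdd 1)
    {ψ : AddChar L ℂ} (hψ : ψ ≠ 1) (hψF : ∀ x, ψ (x ^ p) = ψ x) (i : Multiplicative (ZMod N)) :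
    (N : ℂ) * gaussPeriod ψ f i = (-1) ^ (n * t) * (p ^ e : ℕ) ^ (n * t) - 1
      - if i = Multiplicative.ofAdd (kConst p e n t N : ZMod N)
        then (N : ℂ) * ((-1) ^ (n * t) * (p ^ e : ℕ) ^ (n * t)) else 0 := by
  have : NeZero N := ⟨by rintro rfl; simp at hN⟩
  obtain ⟨f', hf'⟩ := exists_index (N := p ^ e + 1) hγ (by
    have h := card_units_int hL
    obtain ⟨M, hM, -⟩ := exists_pow_two_mul_eq (p ^ e) (n * t)
    rw [← Int.natCast_dvd_natCast, h, hM]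
    exact ⟨((p ^ e : ℕ) - 1) * M, by push_cast; ring⟩)
  let π : Multiplicative (ZMod (p ^ e + 1)) →* Multiplicative (ZMod N) :=
    (ZMod.castHom hN (ZMod N)).toAddMonoidHom.toMultiplicative
  have hπ1 : π (Multiplicative.ofAdd 1) = Multiplicative.ofAdd 1 :=
    congrArg Multiplicative.ofAdd (map_one (ZMod.castHom hN (ZMod N)))
  have hff : f = π.comp f' := index_ext hγ (by rw [hf, MonoidHom.comp_apply, hf', hπ1])
  -- The index modulo N is the reduction of the index modulo P + 1, so a period of order N is a sum
  -- of (P + 1)/N periods of order P + 1.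
  have hsum : gaussPeriod ψ f i = ∑ j with π j = i, gaussPeriod ψ f' j := by
    simp_rw [gaussPeriod]
    rw [Finset.sum_comm]
    refine Finset.sum_congr rfl fun x _ => ?_
    rw [Finset.sum_ite_eq]
    simp [hff]
  have hcard := card_index_fiber hπ1 i
  rw [Fintype.card_multiplicative, ZMod.card] at hcard
  have hne : ((p ^ e + 1 : ℕ) : ℂ) ≠ 0 := Nat.cast_ne_zero.2 (Nat.succ_ne_zero _)
  apply mul_left_cancel₀ hne
  rw [mul_left_comm, hsum, Finset.mul_sum, Finset.sum_congr rfl fun j _ =>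
    succ_mul_gaussPeriod hp he hL hγ hf' hψ hψF j, Finset.sum_sub_distrib, Finset.sum_const,
    Finset.sum_ite_eq', nsmul_eq_mul, mul_sub, ← mul_assoc, ← Nat.cast_mul, hcard, mul_sub]
  have hk : π (Multiplicative.ofAdd (((if 2 < p ∧ Odd (n * t) then (p ^ e + 1) / 2 else 0 : ℕ) :
      ZMod (p ^ e + 1)))) = Multiplicative.ofAdd (kConst p e n t N : ZMod N) := by
    rw [← cast_shift_eq_kConst hp hN]
    exact congrArg Multiplicative.ofAdd (map_natCast (ZMod.castHom hN (ZMod N)) _)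
  simp only [Finset.mem_filter, Finset.mem_univ, true_and, hk, eq_comm (b := i), mul_ite, mul_zero]
  split_ifs <;> ring

end Semiprimitive

/-! ### Counting units of given index and trace by additive characters. -/

section TraceCount

theorem exists_addChar_frobenius_invariant (F : Type*) [Field F] [Finite F] {p : ℕ}
    (hp : p.Prime) [CharP F p] : ∃ ψ : AddChar F ℂ, ψ ≠ 1 ∧ ∀ x, ψ (x ^ p) = ψ x := by
  have := Fact.mk hp
  let := ZMod.algebra F p
  refine ⟨(ZMod.stdAddChar (N := p)).compAddMonoidHom
    (Algebra.trace (ZMod p) F).toAddMonoidHom, fun h => ?_, fun x => ?_⟩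
  · obtain ⟨y, hy⟩ := Algebra.trace_surjective (ZMod p) F 1
    have h1 : ZMod.stdAddChar (N := p) (Algebra.trace (ZMod p) F y) = 1 := by
      simpa using congrArg (fun ψ : AddChar F ℂ => ψ y) h
    rw [hy, ← AddChar.map_zero_eq_one (ZMod.stdAddChar (N := p))] at h1
    exact one_ne_zero (ZMod.injective_stdAddChar h1)
  · have h := Algebra.trace_eq_of_algEquiv
      (FiniteField.frobeniusAlgEquivOfAlgebraic (ZMod p) F) x
    have h1 : FiniteField.frobeniusAlgEquivOfAlgebraic (ZMod p) F x = x ^ p := by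
      simp [ZMod.card]
    rw [h1] at h
    exact congrArg (ZMod.stdAddChar (N := p)) h

/-- Needed so that pulling ψ back along the trace preserves Frobenius invariance. -/
theorem trace_pow_char {F E : Type*} [Field F] [Field E] [Finite E] [Algebra F E] {p : ℕ}
    (hp : p.Prime) [CharP F p] (x : E) :
    Algebra.trace F E (x ^ p) = Algebra.trace F E x ^ p := by
  have := Fact.mk hp
  have : CharP E p := charP_of_injective_algebraMap' F p
  apply (algebraMap F E).injective
  rw [(algebraMap F E).map_pow, FiniteField.algebraMap_trace_eq_sum_pow,
    FiniteField.algebraMap_trace_eq_sum_pow, sum_pow_char]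
  exact Finset.sum_congr rfl fun i _ => by rw [← pow_mul, ← pow_mul, mul_comm]

variable {F E : Type*} [Field F] [Field E] [Algebra F E]

/-- The pullback along the trace of an additive character. -/
noncomputable def AddChar.compTrace (ψ : AddChar F ℂ) (E : Type*) [Field E] [Algebra F E] :
    AddChar E ℂ :=
  ψ.compAddMonoidHom (Algebra.trace F E).toAddMonoidHom

theorem AddChar.compTrace_apply (ψ : AddChar F ℂ) (x : E) :
    ψ.compTrace E x = ψ (Algebra.trace F E x) := rfl

theorem AddChar.compTrace_ne_one [Finite E] {ψ : AddChar F ℂ} (hψ : ψ ≠ 1) :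
    ψ.compTrace E ≠ 1 := by
  have := Finite.of_injective _ (algebraMap F E).injective
  refine fun h => hψ (DFunLike.ext _ _ fun x => ?_)
  obtain ⟨y, rfl⟩ := Algebra.trace_surjective F E x
  rw [← AddChar.compTrace_apply, h, AddChar.one_apply, AddChar.one_apply]

/-- For c = γF^z the condition is t₀z ≡ D modulo lu. Dividing by l leaves a congruence modulo u
whose coefficient t₀/l is prime to u. -/
theorem index_map_eq_iff {γF : Fˣ} {γE : Eˣ} (hγF : ∀ x : Fˣ, x ∈ Subgroup.zpowers γF)
    {t₀ l u : ℕ} (ht₀ : Units.map (algebraMap F E : F →* E) γF = γE ^ t₀)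
    (hl : Nat.gcd t₀ (l * u) = l) (hl0 : 0 < l)
    {fE : Eˣ →* Multiplicative (ZMod (l * u))} (hfE : fE γE = Multiplicative.ofAdd 1)
    {fF : Fˣ →* Multiplicative (ZMod u)} (hfF : fF γF = Multiplicative.ofAdd 1)
    (c : Fˣ) {D : ℤ} (hD : (l : ℤ) ∣ D) {j : ℕ} (hj : ((t₀ / l : ℕ) : ℤ) * j ≡ D / l [ZMOD u]) :
    fE (Units.map (algebraMap F E) c) = Multiplicative.ofAdd (D : ZMod (l * u))
      ↔ fF c = Multiplicative.ofAdd (j : ZMod u) := by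
  obtain ⟨z, rfl⟩ := hγF c
  obtain ⟨D', rfl⟩ := hD
  obtain ⟨t₁, rfl⟩ : l ∣ t₀ := hl ▸ Nat.gcd_dvd_left _ _
  have hl' : (l : ℤ) ≠ 0 := by exact_mod_cast hl0.ne'
  rw [Nat.mul_div_cancel_left _ hl0, Int.mul_ediv_cancel_left _ hl'] at hj
  have hcop : IsCoprime (t₁ : ℤ) u := by
    rw [Nat.isCoprime_iff_coprime]
    rw [Nat.gcd_mul_left] at hl
    exact Nat.eq_of_mul_eq_mul_left hl0 (by rw [hl, mul_one])
  show fE (Units.map (algebraMap F E : F →* E) (γF ^ z)) = _ ↔ fF (γF ^ z) = _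
  rw [map_zpow, ht₀, ← zpow_natCast, ← zpow_mul, index_zpow hfE, index_zpow hfF,
    Multiplicative.ofAdd.injective.eq_iff, Multiplicative.ofAdd.injective.eq_iff,
    ZMod.intCast_eq_intCast_iff_dvd_sub, ← Int.cast_natCast (R := ZMod u),
    ZMod.intCast_eq_intCast_iff_dvd_sub]
  push_cast
  rw [mul_assoc, ← mul_sub, mul_dvd_mul_iff_left hl']
  have h1 := hj.dvd
  constructor
  · intro h
    refine (hcop.symm).dvd_of_dvd_mul_left (y := (t₁ : ℤ)) ?_
    have := h.sub h1
    convert this using 1; ring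
  · intro h
    have := (h.mul_left (t₁ : ℤ)).add h1
    convert this using 1; ring

theorem dvd_of_index_map_eq {γF : Fˣ} {γE : Eˣ} (hγF : ∀ x : Fˣ, x ∈ Subgroup.zpowers γF)
    {t₀ l u : ℕ} (ht₀ : Units.map (algebraMap F E : F →* E) γF = γE ^ t₀)
    (hl : l ∣ t₀)
    {fE : Eˣ →* Multiplicative (ZMod (l * u))} (hfE : fE γE = Multiplicative.ofAdd 1)
    (c : Fˣ) {D : ℤ}
    (h : fE (Units.map (algebraMap F E) c) = Multiplicative.ofAdd (D : ZMod (l * u))) :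
    (l : ℤ) ∣ D := by
  obtain ⟨z, rfl⟩ := hγF c
  obtain ⟨t₁, rfl⟩ := hl
  change fE (Units.map (algebraMap F E : F →* E) (γF ^ z)) = _ at h
  rw [map_zpow, ht₀, ← zpow_natCast, ← zpow_mul, index_zpow hfE,
    Multiplicative.ofAdd.injective.eq_iff, ZMod.intCast_eq_intCast_iff_dvd_sub] at h
  push_cast at h
  have h1 : (l : ℤ) ∣ D - l * t₁ * z := (Dvd.intro _ rfl).trans h
  rw [mul_assoc] at h1
  exact (Int.dvd_iff_dvd_of_dvd_sub h1).2 (Dvd.intro _ rfl)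

variable [Fintype F] [Fintype Eˣ] [Fintype Fˣ] {N : ℕ}

-- Orthogonality of the characters y ↦ ψ(cy) detects the trace; c = 0 gives the size of the fibre
-- and each c ≠ 0 a period of a shifted class.
open scoped Classical in
theorem card_mul_card_trace_eq {ψ : AddChar F ℂ} (hψ : ψ ≠ 1)
    (f : Eˣ →* Multiplicative (ZMod N)) (i : Multiplicative (ZMod N)) (b : F) :
    (Fintype.card F : ℂ)
        * (Finset.univ.filter fun x : Eˣ => f x = i ∧ Algebra.trace F E x = b).card
      = (Finset.univ.filter fun x : Eˣ => f x = i).card + ∑ c : Fˣ, ψ (-(c * b))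
          * gaussPeriod (ψ.compTrace E) f (i * f (Units.map (algebraMap F E) c)) := by
  have h1 : ∀ y : F, ∑ c : F, ψ (c * (y - b)) = if y = b then (Fintype.card F : ℂ) else 0 := by
    intro y
    simp_rw [mul_comm _ (y - b)]
    have h := AddChar.sum_mulShift (y - b) (AddChar.IsPrimitive.of_ne_one hψ)
    simp_rw [mul_comm _ (y - b), sub_eq_zero] at h
    rw [h]; push_cast; rfl
  rw [Finset.card_filter, Finset.card_filter]
  push_cast
  rw [Finset.mul_sum]
  have h2 : ∀ x : Eˣ, (Fintype.card F : ℂ) * (if f x = i ∧ Algebra.trace F E x = b then 1 else 0)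
      = ∑ c : F, if f x = i then ψ (-(c * b)) * ψ.compTrace E (algebraMap F E c * x) else 0 := by
    intro x
    by_cases hx : f x = i
    · simp only [hx, true_and, if_true]
      rw [mul_ite, mul_one, mul_zero, ← h1]
      refine Finset.sum_congr rfl fun c _ => ?_
      rw [AddChar.compTrace_apply, ← Algebra.smul_def, map_smul, smul_eq_mul,
        ← AddChar.map_add_eq_mul]
      congr 1; ring
    · simp [hx]
  rw [Finset.sum_congr rfl fun x _ => h2 x, Finset.sum_comm, sum_eq_zero_add_sum_units]
  congr 1
  · simp
  · refine Finset.sum_congr rfl fun c _ => ?_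
    rw [← gaussPeriod_mul, Finset.mul_sum]
    simp

end TraceCount

/-! ### Evaluation of the counts for trace zero and nonzero trace. -/

section Counting

theorem sum_units_mul_addChar_neg_mul {F : Type*} [Field F] [Fintype Fˣ]
    (ψ : AddChar F ℂ) {b : F} {a : Fˣ}
    (ha : (a : F) = -b⁻¹) (g : Fˣ → ℂ) : ∑ c : Fˣ, g c * ψ (-(c * b)) = ∑ c : Fˣ, g (a * c) * ψ c := by
  have hb : b ≠ 0 := by
    rintro rfl
    simp at ha
  rw [← Equiv.sum_comp (Equiv.mulLeft a)]
  refine Finset.sum_congr rfl fun c _ => ?_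
  rw [Equiv.coe_mulLeft, Units.val_mul, ha]
  congr 2
  field_simp

variable {F E : Type*} [Field F] [Field E] [Algebra F E]
  [Fintype F] [Fintype E] [Fintype Eˣ] [Fintype Fˣ] {p e n t N : ℕ} {γE : Eˣ} {γF : Fˣ}

theorem card_units_eq_sub_one (L : Type*) [Field L] [Fintype L] [Fintype Lˣ] :
    Fintype.card Lˣ = Fintype.card L - 1 := by
  rw [← Nat.card_eq_fintype_card, ← Nat.card_eq_fintype_card, Nat.card_units]

theorem cast_card_units (L : Type*) [Field L] [Fintype L] [Fintype Lˣ] :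
    ((Fintype.card Lˣ : ℕ) : ℂ) = Fintype.card L - 1 := by
  rw [card_units_eq_sub_one, Nat.cast_sub Fintype.card_pos, Nat.cast_one]

open scoped Classical in
theorem mul_card_trace_eq (hp : p.Prime) [CharP F p] (he : 1 ≤ e)
    (hE : Fintype.card E = (p ^ e) ^ (2 * (n * t))) (hγE : ∀ x : Eˣ, x ∈ Subgroup.zpowers γE)
    (hN : N ∣ p ^ e + 1) {f : Eˣ →* Multiplicative (ZMod N)} (hf : f γE = Multiplicative.ofAdd 1)
    {ψ : AddChar F ℂ} (hψ : ψ ≠ 1) (hψF : ∀ x, ψ (x ^ p) = ψ x) (i : ℕ) (b : F) :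
    (N : ℂ) * (Fintype.card F * (Finset.univ.filter fun x : Eˣ =>
        f x = Multiplicative.ofAdd (i : ZMod N) ∧ Algebra.trace F E x = b).card)
      = (Fintype.card E - 1)
        + ((-1) ^ (n * t) * (p ^ e : ℕ) ^ (n * t) - 1) * ∑ c : Fˣ, ψ (-(c * b))
        - N * ((-1) ^ (n * t) * (p ^ e : ℕ) ^ (n * t))
          * ∑ c : Fˣ, if f (Units.map (algebraMap F E) c)
              = Multiplicative.ofAdd (((kConst p e n t N : ℤ) - i : ℤ) : ZMod N)
            then ψ (-(c * b)) else 0 := by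
  have : NeZero N := ⟨by rintro rfl; simp at hN⟩
  have : CharP E p := charP_of_injective_algebraMap' F p
  have hcard : (N : ℂ) * (Finset.univ.filter fun x : Eˣ =>
      f x = Multiplicative.ofAdd (i : ZMod N)).card = Fintype.card E - 1 := by
    rw [← Nat.cast_mul, card_index_fiber hf, cast_card_units]
  have hiff : ∀ c : Fˣ, Multiplicative.ofAdd (i : ZMod N) * f (Units.map (algebraMap F E) c)
        = Multiplicative.ofAdd (kConst p e n t N : ZMod N)
      ↔ f (Units.map (algebraMap F E) c)
        = Multiplicative.ofAdd (((kConst p e n t N : ℤ) - i : ℤ) : ZMod N) := by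
    intro c
    push_cast
    rw [← eq_inv_mul_iff_mul_eq, sub_eq_neg_add, ofAdd_add, ofAdd_neg]
  rw [card_mul_card_trace_eq hψ, mul_add, hcard, Finset.mul_sum, add_sub_assoc]
  congr 1
  rw [Finset.mul_sum, Finset.mul_sum, ← Finset.sum_sub_distrib]
  refine Finset.sum_congr rfl fun c _ => ?_
  rw [mul_left_comm, mul_gaussPeriod_of_dvd hp he hE hγE hN hf (AddChar.compTrace_ne_one hψ)
    (fun x => by rw [AddChar.compTrace_apply, trace_pow_char hp, hψF, AddChar.compTrace_apply])]
  simp_rw [hiff]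
  split_ifs <;> ring

variable {l u t₀ : ℕ} {fE : Eˣ →* Multiplicative (ZMod (l * u))}

/-- If `l = gcd(t, l u)`, then `k_u` does not depend on the parity of `t`. -/
theorem kConst_one_eq {p e n t l u : ℕ} (hp : p.Prime) (hlu : l * u ∣ p ^ e + 1)
    (hl : Nat.gcd t (l * u) = l) : kConst p e n 1 u = kConst p e n t u := by
  unfold kConst
  by_cases h : 2 < p ∧ ¬ 2 ∣ (p ^ e + 1) / u
  · suffices h2 : ¬ 2 ∣ t by
      simp [Nat.prime_two.dvd_mul, h2]
    intro ht
    have hodd : Odd (p ^ e) := (hp.odd_of_ne_two h.1.ne').pow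
    have hu : u ∣ p ^ e + 1 := (Dvd.intro_left l rfl).trans hlu
    have hu0 : 0 < u := Nat.pos_of_dvd_of_pos hu (Nat.succ_pos _)
    have h2u : 2 ∣ u := by
      have h1 : 2 ∣ u * ((p ^ e + 1) / u) := by
        rw [Nat.mul_div_cancel' hu]; exact (hodd.add_one).two_dvd
      exact (Nat.prime_two.dvd_mul.1 h1).resolve_right h.2
    have h2l : 2 ∣ l := hl ▸ Nat.dvd_gcd ht (h2u.mul_left l)
    refine h.2 (h2l.trans ?_)
    obtain ⟨v, hv⟩ := hlu
    rw [hv, mul_right_comm, mul_comm _ u, Nat.mul_div_cancel_left _ hu0]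
    exact Dvd.intro _ rfl
  · rw [if_neg (by tauto), if_neg (by tauto)]

theorem exists_mul_modEq {t₀ l u : ℕ} (hl : Nat.gcd t₀ (l * u) = l) (hl0 : 0 < l) (hu : 0 < u)
    (D : ℤ) : ∃ j : ℕ, j < u ∧ ((t₀ / l : ℕ) : ℤ) * j ≡ D [ZMOD u] := by
  have hu' : (u : ℤ) ≠ 0 := by exact_mod_cast hu.ne'
  have hcop : IsCoprime ((t₀ / l : ℕ) : ℤ) u := by
    rw [Nat.isCoprime_iff_coprime]
    have := Nat.coprime_div_gcd_div_gcd (m := t₀) (n := l * u) (by rw [hl]; exact hl0)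
    rwa [hl, Nat.mul_div_cancel_left _ hl0] at this
  obtain ⟨x, y, hxy⟩ := hcop
  refine ⟨(x * D % u).toNat, ?_, ?_⟩
  · have := Int.emod_lt_of_pos (x * D) (by exact_mod_cast hu : (0 : ℤ) < u)
    have := Int.emod_nonneg (x * D) hu'
    omega
  · rw [Int.toNat_of_nonneg (Int.emod_nonneg _ hu')]
    refine ((Int.mod_modEq (x * D) u).mul_left _).trans ?_
    rw [Int.modEq_iff_dvd]
    exact ⟨y * D, by linear_combination (-D) * hxy⟩

open scoped Classical in
theorem mul_card_trace_eq_zero (hp : p.Prime) [CharP F p] (he : 1 ≤ e)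
    (hE : Fintype.card E = (p ^ e) ^ (2 * (n * t))) (hγE : ∀ x : Eˣ, x ∈ Subgroup.zpowers γE)
    (hγF : ∀ x : Fˣ, x ∈ Subgroup.zpowers γF)
    (ht₀ : Units.map (algebraMap F E : F →* E) γF = γE ^ t₀)
    (hlu : l * u ∣ p ^ e + 1) (hq : p ^ e + 1 ∣ Fintype.card F - 1)
    (hl : Nat.gcd t₀ (l * u) = l) (hfE : fE γE = Multiplicative.ofAdd 1) (i : ℕ) :
    ((l * u : ℕ) : ℂ) * (Fintype.card F * (Finset.univ.filter fun x : Eˣ =>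
        fE x = Multiplicative.ofAdd (i : ZMod (l * u)) ∧ Algebra.trace F E x = 0).card)
      = (Fintype.card E - 1)
        + ((-1) ^ (n * t) * (p ^ e : ℕ) ^ (n * t) - 1) * (Fintype.card F - 1)
        - ((-1) ^ (n * t) * (p ^ e : ℕ) ^ (n * t))
          * if (l : ℤ) ∣ (kConst p e n t (l * u) : ℤ) - i then (l : ℂ) * (Fintype.card F - 1)
            else 0 := by
  obtain ⟨ψ, hψ, hψF⟩ := exists_addChar_frobenius_invariant F hp
  have hlu0 : 0 < l * u := Nat.pos_of_dvd_of_pos hlu (Nat.succ_pos _)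
  have hl0 : 0 < l := Nat.pos_of_mul_pos_right hlu0
  have hu0 : 0 < u := Nat.pos_of_mul_pos_left hlu0
  have : NeZero u := ⟨hu0.ne'⟩
  have hcF := cast_card_units F
  rw [mul_card_trace_eq hp he hE hγE hlu hfE hψ hψF]
  simp only [mul_zero, neg_zero, AddChar.map_zero_eq_one, Finset.sum_const, Finset.card_univ,
    nsmul_eq_mul, mul_one, hcF]
  congr 1
  rw [mul_assoc, mul_left_comm]
  congr 1
  rw [← Finset.sum_filter, Finset.sum_const, nsmul_eq_mul, mul_one]
  split_ifs with hD
  · obtain ⟨j, -, hj⟩ := exists_mul_modEq hl hl0 hu0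
      (((kConst p e n t (l * u) : ℤ) - i) / l)
    obtain ⟨fF, hfF⟩ := exists_index (N := u) hγF (by
      rw [Nat.card_eq_fintype_card, card_units_eq_sub_one]
      exact ((Dvd.intro_left l rfl).trans hlu).trans hq)
    simp_rw [index_map_eq_iff hγF ht₀ hl hl0 hfE hfF _ hD hj]
    -- The class modulo u has (q - 1)/u elements, so the factor lu turns it into l(q - 1).
    have := card_index_fiber hfF (Multiplicative.ofAdd (j : ZMod u))
    rw [← hcF, ← this]
    push_cast; ring
  · rw [Finset.filter_false_of_mem]
    · simp
    · exact fun c _ hc => hD (dvd_of_index_map_eq hγF ht₀ (hl ▸ Nat.gcd_dvd_left _ _) hfE c hc)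

open scoped Classical in
theorem mul_card_trace_eq_of_ne_zero (hp : p.Prime) [CharP F p] (he : 1 ≤ e)
    (hE : Fintype.card E = (p ^ e) ^ (2 * (n * t))) (hγE : ∀ x : Eˣ, x ∈ Subgroup.zpowers γE)
    (hN : N ∣ p ^ e + 1) {f : Eˣ →* Multiplicative (ZMod N)} (hf : f γE = Multiplicative.ofAdd 1)
    {ψ : AddChar F ℂ} (hψ : ψ ≠ 1) (hψF : ∀ x, ψ (x ^ p) = ψ x) (i : ℕ)
    {b : F} (hb : b ≠ 0) {ι : ℕ} (hι : ((γE ^ ι : Eˣ) : E) = algebraMap F E (-b⁻¹)) :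
    (N : ℂ) * (Fintype.card F * (Finset.univ.filter fun x : Eˣ =>
        f x = Multiplicative.ofAdd (i : ZMod N) ∧ Algebra.trace F E x = b).card)
      = (Fintype.card E - 1) - ((-1) ^ (n * t) * (p ^ e : ℕ) ^ (n * t) - 1)
        - N * ((-1) ^ (n * t) * (p ^ e : ℕ) ^ (n * t))
          * ∑ c : Fˣ, if f (Units.map (algebraMap F E) c)
              = Multiplicative.ofAdd (((kConst p e n t N : ℤ) - i - ι : ℤ) : ZMod N)
            then ψ c else 0 := by
  -- Replacing c by ac turns ψ(-cb) into ψ(c) and shifts the index by ι.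
  let a : Fˣ := Units.mk0 (-b⁻¹) (neg_ne_zero.2 (inv_ne_zero hb))
  have ha : (a : F) = -b⁻¹ := rfl
  have hfa : f (Units.map (algebraMap F E) a) = Multiplicative.ofAdd (ι : ZMod N) := by
    rw [← index_pow hf]
    exact congrArg f (Units.ext hι.symm)
  rw [mul_card_trace_eq hp he hE hγE hN hf hψ hψF]
  have h1 := sum_units_mul_addChar_neg_mul ψ ha fun _ => 1
  have h2 := sum_units_mul_addChar_neg_mul ψ ha fun c =>
    if f (Units.map (algebraMap F E) c)
      = Multiplicative.ofAdd (((kConst p e n t N : ℤ) - i : ℤ) : ZMod N) then 1 else 0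
  simp only [one_mul, ite_mul, zero_mul, sum_units_addChar hψ] at h1 h2
  have hiff : ∀ c : Fˣ, f (Units.map (algebraMap F E) (a * c))
        = Multiplicative.ofAdd (((kConst p e n t N : ℤ) - i : ℤ) : ZMod N)
      ↔ f (Units.map (algebraMap F E) c)
        = Multiplicative.ofAdd (((kConst p e n t N : ℤ) - i - ι : ℤ) : ZMod N) := by
    intro c
    rw [map_mul, map_mul, hfa, ← eq_inv_mul_iff_mul_eq]
    push_cast
    rw [sub_eq_neg_add _ (ι : ZMod N), ofAdd_add, ofAdd_neg]
  rw [h1, h2]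
  simp_rw [hiff]
  ring

open scoped Classical in
theorem mul_card_trace_eq_of_not_dvd (hp : p.Prime) [CharP F p] (he : 1 ≤ e)
    (hE : Fintype.card E = (p ^ e) ^ (2 * (n * t))) (hγE : ∀ x : Eˣ, x ∈ Subgroup.zpowers γE)
    (hγF : ∀ x : Fˣ, x ∈ Subgroup.zpowers γF)
    (ht₀ : Units.map (algebraMap F E : F →* E) γF = γE ^ t₀)
    (hlu : l * u ∣ p ^ e + 1) (hl : Nat.gcd t₀ (l * u) = l)
    (hfE : fE γE = Multiplicative.ofAdd 1) (i : ℕ)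
    {b : F} (hb : b ≠ 0) {ι : ℕ} (hι : ((γE ^ ι : Eˣ) : E) = algebraMap F E (-b⁻¹))
    (hD : ¬ (l : ℤ) ∣ (kConst p e n t (l * u) : ℤ) - i - ι) :
    ((l * u : ℕ) : ℂ) * (Fintype.card F * (Finset.univ.filter fun x : Eˣ =>
        fE x = Multiplicative.ofAdd (i : ZMod (l * u)) ∧ Algebra.trace F E x = b).card)
      = (Fintype.card E - 1) - ((-1) ^ (n * t) * (p ^ e : ℕ) ^ (n * t) - 1) := by
  obtain ⟨ψ, hψ, hψF⟩ := exists_addChar_frobenius_invariant F hp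
  rw [mul_card_trace_eq_of_ne_zero hp he hE hγE hlu hfE hψ hψF i hb hι,
    Finset.sum_eq_zero fun c _ => if_neg fun hc =>
      hD (dvd_of_index_map_eq hγF ht₀ (hl ▸ Nat.gcd_dvd_left _ _) hfE c hc)]
  ring

open scoped Classical in
theorem mul_card_trace_eq_of_dvd (hp : p.Prime) [CharP F p] (he : 1 ≤ e)
    (hF : Fintype.card F = (p ^ e) ^ (2 * n))
    (hE : Fintype.card E = (p ^ e) ^ (2 * (n * t))) (hγE : ∀ x : Eˣ, x ∈ Subgroup.zpowers γE)
    (hγF : ∀ x : Fˣ, x ∈ Subgroup.zpowers γF)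
    (ht₀ : Units.map (algebraMap F E : F →* E) γF = γE ^ t₀)
    (hlu : l * u ∣ p ^ e + 1) (hq : p ^ e + 1 ∣ Fintype.card F - 1)
    (hl : Nat.gcd t₀ (l * u) = l) (hlt : Nat.gcd t (l * u) = l)
    (hfE : fE γE = Multiplicative.ofAdd 1) (i : ℕ)
    {b : F} (hb : b ≠ 0) {ι : ℕ} (hι : ((γE ^ ι : Eˣ) : E) = algebraMap F E (-b⁻¹))
    (hD : (l : ℤ) ∣ (kConst p e n t (l * u) : ℤ) - i - ι) {j : ℕ}
    (hj : ((t₀ / l : ℕ) : ℤ) * j ≡ ((kConst p e n t (l * u) : ℤ) - i - ι) / l [ZMOD u]) :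
    ((l * u : ℕ) : ℂ) * (Fintype.card F * (Finset.univ.filter fun x : Eˣ =>
        fE x = Multiplicative.ofAdd (i : ZMod (l * u)) ∧ Algebra.trace F E x = b).card)
      = (Fintype.card E - 1) - ((-1) ^ (n * t) * (p ^ e : ℕ) ^ (n * t) - 1)
        - (-1) ^ (n * t) * (p ^ e : ℕ) ^ (n * t) * (l * ((-1) ^ n * (p ^ e : ℕ) ^ n - 1
          - if j ≡ kConst p e n t u [MOD u] then (u : ℂ) * ((-1) ^ n * (p ^ e : ℕ) ^ n)
            else 0)) := by
  obtain ⟨ψ, hψ, hψF⟩ := exists_addChar_frobenius_invariant F hp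
  have hlu0 : 0 < l * u := Nat.pos_of_dvd_of_pos hlu (Nat.succ_pos _)
  have hl0 : 0 < l := Nat.pos_of_mul_pos_right hlu0
  have hu : u ∣ p ^ e + 1 := (Dvd.intro_left l rfl).trans hlu
  obtain ⟨fF, hfF⟩ := exists_index (N := u) hγF (by
    rw [Nat.card_eq_fintype_card, card_units_eq_sub_one]
    exact hu.trans hq)
  rw [mul_card_trace_eq_of_ne_zero hp he hE hγE hlu hfE hψ hψF i hb hι]
  simp_rw [index_map_eq_iff hγF ht₀ hl hl0 hfE hfF _ hD hj]
  -- The remaining sum is itself a semiprimitive period, now of order u over F, where the extension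
  -- degree is 1.
  have h := mul_gaussPeriod_of_dvd (n := n) (t := 1) hp he (by rw [mul_one, hF]) hγF hu hfF hψ hψF
    (Multiplicative.ofAdd (j : ZMod u))
  simp only [mul_one, Multiplicative.ofAdd.injective.eq_iff, ZMod.natCast_eq_natCast_iff,
    kConst_one_eq hp hlu hlt] at h
  rw [← h, gaussPeriod]
  push_cast
  ring

end Counting

/-! ### From trace and norm conditions over K to index and trace conditions over E. -/

section Bridge

theorem modEq_mul_iff_of_gcd {d S μ η i : ℕ} (hd : 0 < d) (hc : Nat.Coprime μ S)
    (hi : μ * i ≡ η [MOD S]) (z : ℤ) :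
    ((d * S : ℕ) : ℤ) ∣ z * (d * μ : ℕ) - (d * η : ℕ) ↔ (S : ℤ) ∣ z - i := by
  have hd' : (d : ℤ) ≠ 0 := by exact_mod_cast hd.ne'
  have h1 : z * (d * μ : ℕ) - (d * η : ℕ) = d * (z * μ - η) := by push_cast; ring
  rw [h1, Nat.cast_mul, mul_dvd_mul_iff_left hd']
  have h2 : (S : ℤ) ∣ η - μ * i := by exact_mod_cast hi.dvd
  have hcop : IsCoprime (S : ℤ) μ := (Nat.isCoprime_iff_coprime.2 hc).symm
  constructor
  · intro h
    refine hcop.dvd_of_dvd_mul_left (y := (μ : ℤ)) ?_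
    have := h.add h2
    convert this using 1; ring
  · intro h
    have := (h.mul_left (μ : ℤ)).sub h2
    convert this using 1; ring

variable {F K : Type*} [Field F] [Field K] [Finite K] [Algebra F K]
  {E : IntermediateField F K} {γ : Kˣ}

theorem mem_zpowers_unitNorm (E : Type*) [Field E] [Algebra E K]
    (hγ : ∀ x : Kˣ, x ∈ Subgroup.zpowers γ) (x : Eˣ) :
    x ∈ Subgroup.zpowers (unitNorm E γ) := by
  obtain ⟨y, rfl⟩ := FiniteField.unitsMap_norm_surjective E K x
  obtain ⟨z, rfl⟩ := hγ y
  exact ⟨z, (map_zpow (Units.map (Algebra.norm E : K →* E)) γ z).symm⟩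

theorem trace_coe_intermediateField (x : E) :
    Algebra.trace F K (x : K) = (Module.finrank E K : F) * Algebra.trace F E x := by
  rw [← Algebra.trace_trace (S := E), show (x : K) = algebraMap E K x from rfl,
    Algebra.trace_algebraMap, map_nsmul, nsmul_eq_mul]

theorem norm_coe_intermediateField (x : E) :
    Algebra.norm F (x : K) = Algebra.norm F x ^ Module.finrank E K := by
  rw [← Algebra.norm_norm (S := E), show (x : K) = algebraMap E K x from rfl,
    Algebra.norm_algebraMap, map_pow]

theorem unitNorm_unitNorm : unitNorm F (unitNorm E γ) = unitNorm F γ :=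
  Units.ext (Algebra.norm_norm (S := E))

variable [Finite F]

open scoped Classical in
theorem ncard_traceNormSet [Fintype Eˣ] (hγ : ∀ x : Kˣ, x ∈ Subgroup.zpowers γ)
    {s h d S i : ℕ} (hs : s ∣ Nat.card F - 1) (hd : d = Nat.gcd (Module.finrank E K) s)
    (hd0 : 0 < d) (hdS : s = d * S) (hdh : d ∣ h)
    (hi : Module.finrank E K / d * i ≡ h / d [MOD S])
    (hmt : (Module.finrank E K : F) ≠ 0)
    {f : Eˣ →* Multiplicative (ZMod S)} (hf : f (unitNorm E γ) = Multiplicative.ofAdd 1) (a : F) :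
    (traceNormSet E γ a s h).ncard = (Finset.univ.filter fun x : Eˣ =>
      f x = Multiplicative.ofAdd (i : ZMod S)
        ∧ Algebra.trace F E x = a / (Module.finrank E K : F)).card := by
  rw [← Set.ncard_coe_finset, ← Set.ncard_image_of_injective _ (Units.val_injective (α := E))]
  congr 1
  obtain ⟨fs, hfs⟩ := exists_index (N := s) (mem_zpowers_unitNorm F hγ) (by
    rwa [Nat.card_units])
  -- For x = γ_t^z the norm is g^(z·m/t), so the coset condition reads z·(m/t) ≡ h modulo s, which
  -- is solved by z ≡ i modulo S.
  have hnorm : ∀ x : Eˣ, (∃ y ∈ Subgroup.zpowers (unitNorm F γ ^ s),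
      Algebra.norm F ((x : E) : K) = ((unitNorm F γ ^ h * y : Fˣ) : F))
      ↔ f x = Multiplicative.ofAdd (i : ZMod S) := by
    intro x
    obtain ⟨z, rfl⟩ := mem_zpowers_unitNorm E hγ x
    have h1 : Algebra.norm F (((unitNorm E γ ^ z : Eˣ) : E) : K)
        = ((unitNorm F γ ^ (z * (Module.finrank E K : ℕ)) : Fˣ) : F) := by
      rw [norm_coe_intermediateField, zpow_mul, zpow_natCast, Units.val_pow_eq_pow_val]
      congr 1
      rw [← unitNorm_unitNorm (E := E)]
      exact congrArg Units.val
        (map_zpow (Units.map (Algebra.norm F : E →* F)) (unitNorm E γ) z)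
    simp only [h1, Units.val_inj]
    have h2 : (∃ y ∈ Subgroup.zpowers (unitNorm F γ ^ s),
        unitNorm F γ ^ (z * (Module.finrank E K : ℕ)) = unitNorm F γ ^ h * y)
        ↔ fs (unitNorm F γ ^ (z * (Module.finrank E K : ℕ))) = fs (unitNorm F γ ^ h) := by
      constructor
      · rintro ⟨y, ⟨v, rfl⟩, hy⟩
        rw [hy, map_mul]
        simp only [map_zpow]
        rw [(index_eq_one_iff (mem_zpowers_unitNorm F hγ) hfs _).2 ⟨_, rfl⟩]
        simp
      · intro h3
        have h4 : fs ((unitNorm F γ ^ h)⁻¹ * unitNorm F γ ^ (z * (Module.finrank E K : ℕ))) = 1 := by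
          rw [map_mul, map_inv, h3, inv_mul_cancel]
        obtain ⟨w, hw⟩ := (index_eq_one_iff (mem_zpowers_unitNorm F hγ) hfs _).1 h4
        obtain ⟨v, rfl⟩ := mem_zpowers_unitNorm F hγ w
        refine ⟨_, ⟨v, rfl⟩, ?_⟩
        rw [eq_comm, ← eq_inv_mul_iff_mul_eq, ← hw]
        simp only [← zpow_natCast, ← zpow_mul]
        rw [mul_comm]
    rw [h2, index_zpow hfs, index_pow hfs, index_zpow hf,
      Multiplicative.ofAdd.injective.eq_iff,
      Multiplicative.ofAdd.injective.eq_iff, ← Int.cast_natCast (R := ZMod s) h,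
      ← Int.cast_natCast (R := ZMod S) i, eq_comm, ZMod.intCast_eq_intCast_iff_dvd_sub, eq_comm,
      ZMod.intCast_eq_intCast_iff_dvd_sub]
    obtain ⟨η, rfl⟩ := hdh
    obtain ⟨μ, hμ⟩ : d ∣ Module.finrank E K := hd ▸ Nat.gcd_dvd_left _ _
    rw [hμ] at hi hd ⊢
    rw [Nat.mul_div_cancel_left _ hd0, Nat.mul_div_cancel_left _ hd0] at hi
    rw [hdS, Nat.gcd_mul_left] at hd
    have hc : Nat.Coprime μ S := Nat.eq_of_mul_eq_mul_left hd0 (by rw [mul_one]; exact hd.symm)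
    rw [hdS]
    exact modEq_mul_iff_of_gcd hd0 hc hi z
  ext x
  simp only [traceNormSet, Set.mem_ofPred_eq, Set.mem_image, Finset.coe_filter, Finset.mem_univ,
    true_and]
  constructor
  · rintro ⟨htr, y, hy, hny⟩
    have hx : x ≠ 0 := by
      rintro rfl
      have h0 : Algebra.norm F ((0 : E) : K) = 0 := by simp
      exact Units.ne_zero _ (hny.symm.trans h0)
    refine ⟨Units.mk0 x hx, ⟨(hnorm _).1 ⟨y, hy, hny⟩, ?_⟩, rfl⟩
    rw [eq_div_iff hmt, mul_comm, Units.val_mk0, ← trace_coe_intermediateField, htr]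
  · rintro ⟨x, ⟨hfx, htr⟩, rfl⟩
    refine ⟨?_, (hnorm x).2 hfx⟩
    rw [trace_coe_intermediateField, htr, mul_div_cancel₀ _ hmt]

end Bridge

/-! ### Congruences for the constants, and assembly of the theorem. -/

theorem gcd_geom_eq {q t S : ℕ} (hq : 2 ≤ q) (hS : S ∣ q - 1) :
    Nat.gcd ((q ^ t - 1) / (q - 1)) S = Nat.gcd t S := by
  refine Nat.ModEq.gcd_eq ?_
  rw [← Nat.geomSum_eq hq]
  have h1 : q ≡ 1 [MOD S] := ((Nat.modEq_iff_dvd' (by omega)).2 hS).symm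
  induction t with
  | zero => rfl
  | succ t ih =>
    rw [Finset.sum_range_succ]
    exact ih.add (by simpa using h1.pow t)

/-- Both k_S and k_l are reductions of the same integer, 0 or (P + 1)/2, so they agree modulo l. -/
theorem dvd_sub_iff_modEq_kConst {p e n t l S i : ℕ} (hp : p.Prime) (hS : S ∣ p ^ e + 1)
    (hl : l ∣ S) :
    (l : ℤ) ∣ (kConst p e n t S : ℤ) - i ↔ i ≡ kConst p e n t l [MOD l] := by
  have h1 := (ZMod.natCast_eq_natCast_iff _ _ _).1 (cast_shift_eq_kConst (n := n) (t := t) hp hS)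
  have h2 := (ZMod.natCast_eq_natCast_iff _ _ _).1
    (cast_shift_eq_kConst (n := n) (t := t) hp (hl.trans hS))
  have h3 := (h1.of_dvd hl).symm.trans h2
  rw [← Nat.modEq_iff_dvd]
  exact ⟨fun h => h.trans h3, fun h => h.trans h3.symm⟩

theorem mainTheorem4 {F K : Type*} [Field F] [Finite F] [Field K] [Finite K] [Algebra F K]
    (p q r s h m t e n d l u : ℕ)
    -- `F = 𝔽_q`, `q = p ^ r`, `r = 2 e n`
    (hp : p.Prime) (hq : q = p ^ r) (hF : Nat.card F = q) (hr : r = 2 * e * n)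
    (hs : s ∣ p ^ e + 1) (hh : h < s)
    -- `K = 𝔽_{q^m}`, `E = 𝔽_{q^t}`
    (hm : 2 ≤ m) (hK : Module.finrank F K = m)
    (E : IntermediateField F K) (hE : Module.finrank F E = t)
    -- `γ` is a primitive element of `K`
    (γ : Kˣ) (hγ : ∀ x : Kˣ, x ∈ Subgroup.zpowers γ)
    (hd : d = Nat.gcd (m / t) s) (hl : l = Nat.gcd t (s / d)) (hu : u = s / (d * l))
    (hpt : ¬ p ∣ m / t) (hdh : d ∣ h)
    (a : F) :
    -- the table, with `i₀` the solution of `(m / (d t)) i₀ ≡ h / d (mod s / d)` in `[0, s / d)`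
    (∀ i₀ : ℕ, i₀ < s / d → m / (d * t) * i₀ ≡ h / d [MOD s / d] →
      (a = 0 →
        ((1 < l ∧ ¬ i₀ ≡ kConst p e n t l [MOD l]) →
          ((traceNormSet E γ a s h).ncard : ℝ) =
            (d : ℝ) / s * ((q : ℝ) ^ (t - 1) - 1
              + (-1) ^ (n * t) * ((q : ℝ) - 1) * √((q : ℝ) ^ ((t : ℤ) - 2)))) ∧
        ((l = 1 ∨ (1 < l ∧ i₀ ≡ kConst p e n t l [MOD l])) →
          ((traceNormSet E γ a s h).ncard : ℝ) =
            (d : ℝ) / s * ((q : ℝ) ^ (t - 1) - 1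
              - (-1) ^ (n * t) * ((q : ℝ) - 1) * ((l : ℝ) - 1)
                  * √((q : ℝ) ^ ((t : ℤ) - 2))))) ∧
      (a ≠ 0 →
        -- `ι` is the index of `a₀ = -m / (t a)` with respect to `γ_t`
        ∀ ι : ℕ, ((unitNorm E γ ^ ι : Eˣ) : E) = algebraMap F E (-((m / t : ℕ) : F) / a) →
          (¬ (l : ℤ) ∣ (kConst p e n t (s / d) : ℤ) - i₀ - ι →
            ((traceNormSet E γ a s h).ncard : ℝ) =
              (d : ℝ) / s * ((q : ℝ) ^ (t - 1)
                - (-1) ^ (n * t) * √((q : ℝ) ^ ((t : ℤ) - 2)))) ∧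
          ((l : ℤ) ∣ (kConst p e n t (s / d) : ℤ) - i₀ - ι →
            -- `j₀` is the solution of `(t₀ / l) j₀ ≡ (k_{s/d} - i₀ - ι) / l (mod u)` in `[0, u)`,
            -- where `t₀ = (q ^ t - 1) / (q - 1)`
            ∀ j₀ : ℕ, j₀ < u →
              (((q ^ t - 1) / (q - 1) / l : ℕ) : ℤ) * j₀
                ≡ ((kConst p e n t (s / d) : ℤ) - i₀ - ι) / l [ZMOD u] →
              ((1 < u ∧ ¬ j₀ ≡ kConst p e n t u [MOD u]) →
                ((traceNormSet E γ a s h).ncard : ℝ) =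
                  (d : ℝ) / s * ((q : ℝ) ^ (t - 1)
                    - (-1) ^ (n * t) * (((-1) ^ n * √(q : ℝ) - 1) * l + 1)
                        * √((q : ℝ) ^ ((t : ℤ) - 2)))) ∧
              ((u = 1 ∨ (1 < u ∧ j₀ ≡ kConst p e n t u [MOD u])) →
                ((traceNormSet E γ a s h).ncard : ℝ) =
                  (d : ℝ) / s * ((q : ℝ) ^ (t - 1)
                    - (-1) ^ (n * t)
                        * (((-1) ^ (n - 1) * ((u : ℝ) - 1) * √(q : ℝ) - 1) * l + 1)
                        * √((q : ℝ) ^ ((t : ℤ) - 2))))))) ∧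
    -- the two special cases
    (a = 0 → l = 1 →
      ((traceNormSet E γ a s h).ncard : ℝ) = (d : ℝ) / s * ((q : ℝ) ^ (t - 1) - 1)) ∧
    (a ≠ 0 → d = s →
      ((traceNormSet E γ a s h).ncard : ℝ) = (q : ℝ) ^ (t - 1)) := by
  classical
  have := Fintype.ofFinite F
  have := Fintype.ofFinite E
  have := Fintype.ofFinite Eˣ
  have := Fintype.ofFinite Fˣ
  have hmul : t * Module.finrank E K = m := by rw [← hE, ← hK, Module.finrank_mul_finrank]
  have ht0 : 0 < t := Nat.pos_of_ne_zero (by rintro rfl; omega)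
  have hfr : Module.finrank E K = m / t := by rw [← hmul, Nat.mul_div_cancel_left _ ht0]
  -- A field has at least two elements, which forces r, and hence e and n, to be positive.
  have hr0 : r ≠ 0 := by
    rintro rfl
    have := Finite.one_lt_card (α := F)
    rw [hF, hq, pow_zero] at this
    omega
  have hF' : Fintype.card F = q := by rw [← Nat.card_eq_fintype_card, hF]
  have := Fact.mk hp
  have : CharP F p := charP_of_card_eq_prime_pow (f := r) (by rw [hF', hq])
  have he : 1 ≤ e := Nat.one_le_iff_ne_zero.2 (by rintro rfl; simp at hr; exact hr0 hr)
  have hn : 1 ≤ n := Nat.one_le_iff_ne_zero.2 (by rintro rfl; simp at hr; exact hr0 hr)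
  have hqP : q = (p ^ e) ^ (2 * n) := by rw [hq, hr, ← pow_mul]; congr 1; ring
  have hE' : Fintype.card E = q ^ t := by rw [Module.card_eq_pow_finrank (K := F), hF', hE]
  have hE'' : Fintype.card E = (p ^ e) ^ (2 * (n * t)) := by
    rw [hE', hqP, ← pow_mul]; congr 1; ring
  have hq2 : 2 ≤ q := by rw [← hF']; exact Fintype.one_lt_card
  have hs0 : 0 < s := by omega
  have hd0 : 0 < d := hd ▸ Nat.gcd_pos_of_pos_right _ hs0
  have hds : d ∣ s := hd ▸ Nat.gcd_dvd_right _ _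
  have hPq : p ^ e + 1 ∣ q - 1 := by
    have h1 := Nat.sub_dvd_pow_sub_pow ((p ^ e) ^ 2) 1 n
    rw [one_pow, ← pow_mul (p ^ e) 2 n, ← hqP] at h1
    exact (Dvd.intro _ (Nat.sq_sub_sq (p ^ e) 1).symm).trans (by simpa using h1)
  have hld : l ∣ s / d := hl ▸ Nat.gcd_dvd_right _ _
  have hS : s / d = l * u := by
    rw [hu, ← Nat.div_div_eq_div_mul, Nat.mul_div_cancel' hld]
  have hsd : s = d * (l * u) := by rw [← hS, Nat.mul_div_cancel' hds]
  have hlu : l * u ∣ p ^ e + 1 := (Dvd.intro_left d hsd.symm).trans hs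
  have hlu0 : 0 < l * u := Nat.pos_of_dvd_of_pos hlu (Nat.succ_pos _)
  have hl0 : 0 < l := Nat.pos_of_mul_pos_right hlu0
  have hu0 : 0 < u := Nat.pos_of_mul_pos_left hlu0
  have hlt : Nat.gcd t (l * u) = l := by rw [← hS, hl]
  have hmtF : ((m / t : ℕ) : F) ≠ 0 := by rwa [Ne, CharP.cast_eq_zero_iff F p]
  have hlt₀ : Nat.gcd ((q ^ t - 1) / (q - 1)) (l * u) = l := by
    rw [gcd_geom_eq hq2 (hlu.trans hPq), hlt]
  have hγE := mem_zpowers_unitNorm E hγ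
  have hγF := mem_zpowers_unitNorm F hγ
  have ht₀ : Units.map (algebraMap F E : F →* E) (unitNorm F γ)
      = unitNorm E γ ^ ((q ^ t - 1) / (q - 1)) := by
    apply Units.ext
    rw [← unitNorm_unitNorm (E := E)]
    have h := FiniteField.algebraMap_norm_eq_pow (K := F) (x := ((unitNorm E γ : Eˣ) : E))
    rw [Nat.card_eq_fintype_card, Nat.card_eq_fintype_card, hE', hF'] at h
    rw [Units.val_pow_eq_pow_val, ← h]
    rfl
  obtain ⟨f, hf⟩ := exists_index (N := l * u) hγE (by
    rw [Nat.card_units, Nat.card_eq_fintype_card, hE']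
    refine (hlu.trans hPq).trans ?_
    simpa using Nat.sub_dvd_pow_sub_pow q 1 t)
  rw [hS]
  have hdiv : m / (d * t) = m / t / d := by rw [mul_comm d t, Nat.div_div_eq_div_mul]
  -- R is √q, so every square root becomes a quotient of powers of R, also for t = 1, where the
  -- exponent t - 2 is negative.
  set R : ℝ := ((p ^ e : ℕ) : ℝ) ^ n with hR
  have hR0 : 0 < R := pow_pos (by exact_mod_cast Nat.pow_pos hp.pos) _
  have hqR : (q : ℝ) = R ^ 2 := by rw [hqP, hR]; push_cast; ring
  have hsq1 : √(q : ℝ) = R := by rw [hqR, Real.sqrt_sq hR0.le]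
  have hsq2 : √((q : ℝ) ^ ((t : ℤ) - 2)) = R ^ t / R ^ 2 := by
    rw [hqR, zpow_sub₀ (by positivity), zpow_natCast,
      show (R ^ 2) ^ t / (R ^ 2) ^ (2 : ℤ) = (R ^ t / R ^ 2) ^ 2 by
        rw [zpow_ofNat, div_pow, ← pow_mul R 2 t, ← pow_mul R t 2, mul_comm t 2],
      Real.sqrt_sq (by positivity)]
  have hqt : (q : ℝ) ^ (t - 1) = R ^ t * R ^ t / R ^ 2 := by
    rw [eq_div_iff (by positivity), ← hqR, ← pow_succ, Nat.sub_add_cancel ht0, hqR]; ring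
  have hPnt : ((p ^ e : ℕ) : ℝ) ^ (n * t) = R ^ t := by rw [hR, pow_mul]
  have hρ : (-1 : ℝ) ^ (n - 1) = -(-1) ^ n := by
    conv_rhs => rw [← Nat.sub_add_cancel hn, pow_succ]
    ring
  have hdsR : (d : ℝ) / s = 1 / (l * u) := by
    have : (d : ℝ) ≠ 0 := by exact_mod_cast hd0.ne'
    rw [hsd]; push_cast
    rw [div_mul_eq_div_div, div_self this]
  have hl0R : (l : ℝ) ≠ 0 := by exact_mod_cast hl0.ne'
  have hu0R : (u : ℝ) ≠ 0 := by exact_mod_cast hu0.ne'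
  have hER : (Fintype.card E : ℝ) = R ^ t * R ^ t := by
    rw [hE']; push_cast; rw [hqR]; ring
  have hFR : (Fintype.card F : ℝ) = R ^ 2 := by rw [hF', hqR]
  have hncard : ∀ i₀ : ℕ, m / (d * t) * i₀ ≡ h / d [MOD (l * u)] →
      (traceNormSet E γ a s h).ncard = (Finset.univ.filter fun x : Eˣ =>
        f x = Multiplicative.ofAdd (i₀ : ZMod (l * u))
          ∧ Algebra.trace F E x = a / ((m / t : ℕ) : F)).card := by
    intro i₀ hi₀
    have := ncard_traceNormSet (E := E) (d := d) (S := l * u) (i := i₀) hγ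
      (by rw [hF]; exact hs.trans hPq) (by rw [hfr, hd]) hd0 hsd hdh
      (by rwa [hfr, ← hdiv]) (by rwa [hfr]) hf a
    rwa [hfr] at this
  have key : ∀ i₀ : ℕ, i₀ < l * u → m / (d * t) * i₀ ≡ h / d [MOD (l * u)] → (a = 0 →
        ((1 < l ∧ ¬ i₀ ≡ kConst p e n t l [MOD l]) →
          ((traceNormSet E γ a s h).ncard : ℝ) =
            (d : ℝ) / s * ((q : ℝ) ^ (t - 1) - 1
              + (-1) ^ (n * t) * ((q : ℝ) - 1) * √((q : ℝ) ^ ((t : ℤ) - 2)))) ∧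
        ((l = 1 ∨ (1 < l ∧ i₀ ≡ kConst p e n t l [MOD l])) →
          ((traceNormSet E γ a s h).ncard : ℝ) =
            (d : ℝ) / s * ((q : ℝ) ^ (t - 1) - 1
              - (-1) ^ (n * t) * ((q : ℝ) - 1) * ((l : ℝ) - 1)
                  * √((q : ℝ) ^ ((t : ℤ) - 2))))) ∧
      (a ≠ 0 →
        ∀ ι : ℕ, ((unitNorm E γ ^ ι : Eˣ) : E) = algebraMap F E (-((m / t : ℕ) : F) / a) →
          (¬ (l : ℤ) ∣ (kConst p e n t (l * u) : ℤ) - i₀ - ι →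
            ((traceNormSet E γ a s h).ncard : ℝ) =
              (d : ℝ) / s * ((q : ℝ) ^ (t - 1)
                - (-1) ^ (n * t) * √((q : ℝ) ^ ((t : ℤ) - 2)))) ∧
          ((l : ℤ) ∣ (kConst p e n t (l * u) : ℤ) - i₀ - ι →
            ∀ j₀ : ℕ, j₀ < u →
              (((q ^ t - 1) / (q - 1) / l : ℕ) : ℤ) * j₀
                ≡ ((kConst p e n t (l * u) : ℤ) - i₀ - ι) / l [ZMOD u] →
              ((1 < u ∧ ¬ j₀ ≡ kConst p e n t u [MOD u]) →
                ((traceNormSet E γ a s h).ncard : ℝ) =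
                  (d : ℝ) / s * ((q : ℝ) ^ (t - 1)
                    - (-1) ^ (n * t) * (((-1) ^ n * √(q : ℝ) - 1) * l + 1)
                        * √((q : ℝ) ^ ((t : ℤ) - 2)))) ∧
              ((u = 1 ∨ (1 < u ∧ j₀ ≡ kConst p e n t u [MOD u])) →
                ((traceNormSet E γ a s h).ncard : ℝ) =
                  (d : ℝ) / s * ((q : ℝ) ^ (t - 1)
                    - (-1) ^ (n * t)
                        * (((-1) ^ (n - 1) * ((u : ℝ) - 1) * √(q : ℝ) - 1) * l + 1)
                        * √((q : ℝ) ^ ((t : ℤ) - 2))))))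
  · intro i₀ hi₀ hi
    rw [hncard i₀ hi, hqt, hsq2, hsq1, hqR, hdsR, hρ]
    refine ⟨fun ha => ?_, fun ha ι hι => ?_⟩
    · rw [ha, zero_div]
      have hX := mul_card_trace_eq_zero hp he hE'' hγE hγF ht₀ hlu (by rwa [hF']) hlt₀ hf i₀
      have hiff := dvd_sub_iff_modEq_kConst (n := n) (t := t) (i := i₀) hp hlu (Dvd.intro _ rfl)
      generalize Finset.card _ = X at hX ⊢
      refine ⟨fun ⟨_, h2⟩ => ?_, fun h2 => ?_⟩
      · rw [if_neg (mt hiff.1 h2)] at hX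
        have hXR : ((l * u : ℕ) : ℝ) * (Fintype.card F * X) = (Fintype.card E - 1)
            + ((-1) ^ (n * t) * (p ^ e : ℕ) ^ (n * t) - 1) * (Fintype.card F - 1)
            - ((-1) ^ (n * t) * (p ^ e : ℕ) ^ (n * t)) * 0 := by exact_mod_cast hX
        rw [hER, hFR, hPnt] at hXR
        push_cast at hXR
        field_simp
        linear_combination hXR
      · have h3 : i₀ ≡ kConst p e n t l [MOD l] := by
          rcases h2 with rfl | h2
          · exact Nat.modEq_one
          · exact h2.2
        rw [if_pos (hiff.2 h3)] at hX
        have hXR : ((l * u : ℕ) : ℝ) * (Fintype.card F * X) = (Fintype.card E - 1)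
            + ((-1) ^ (n * t) * (p ^ e : ℕ) ^ (n * t) - 1) * (Fintype.card F - 1)
            - ((-1) ^ (n * t) * (p ^ e : ℕ) ^ (n * t)) * (l * (Fintype.card F - 1)) := by
          exact_mod_cast hX
        rw [hER, hFR, hPnt] at hXR
        push_cast at hXR
        field_simp
        linear_combination hXR
    · have hb : a / ((m / t : ℕ) : F) ≠ 0 := div_ne_zero ha hmtF
      have hι' : ((unitNorm E γ ^ ι : Eˣ) : E)
          = algebraMap F E (-(a / ((m / t : ℕ) : F))⁻¹) := by rw [hι, inv_div, neg_div]
      refine ⟨fun hD => ?_, fun hD j₀ hj₀ hj => ?_⟩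
      · have hX := mul_card_trace_eq_of_not_dvd hp he hE'' hγE hγF ht₀ hlu hlt₀ hf i₀ hb hι' hD
        generalize Finset.card _ = X at hX ⊢
        have hXR : ((l * u : ℕ) : ℝ) * (Fintype.card F * X) = (Fintype.card E - 1)
            - ((-1) ^ (n * t) * (p ^ e : ℕ) ^ (n * t) - 1) := by exact_mod_cast hX
        rw [hER, hFR, hPnt] at hXR
        push_cast at hXR
        field_simp
        linear_combination hXR
      · have hX := mul_card_trace_eq_of_dvd hp he (by rw [hF', hqP]) hE'' hγE hγF ht₀ hlu
          (by rwa [hF']) hlt₀ hlt hf i₀ hb hι' hD hj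
        generalize Finset.card _ = X at hX ⊢
        refine ⟨fun ⟨_, h2⟩ => ?_, fun h2 => ?_⟩
        · rw [if_neg h2] at hX
          have hXR : ((l * u : ℕ) : ℝ) * (Fintype.card F * X) = (Fintype.card E - 1)
              - ((-1) ^ (n * t) * (p ^ e : ℕ) ^ (n * t) - 1)
              - (-1) ^ (n * t) * (p ^ e : ℕ) ^ (n * t)
                * (l * ((-1) ^ n * (p ^ e : ℕ) ^ n - 1 - 0)) := by exact_mod_cast hX
          rw [hER, hFR, hPnt, ← hR] at hXR
          push_cast at hXR
          field_simp
          linear_combination hXR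
        · have h3 : j₀ ≡ kConst p e n t u [MOD u] := by
            rcases h2 with rfl | h2
            · exact Nat.modEq_one
            · exact h2.2
          rw [if_pos h3] at hX
          have hXR : ((l * u : ℕ) : ℝ) * (Fintype.card F * X) = (Fintype.card E - 1)
              - ((-1) ^ (n * t) * (p ^ e : ℕ) ^ (n * t) - 1)
              - (-1) ^ (n * t) * (p ^ e : ℕ) ^ (n * t)
                * (l * ((-1) ^ n * (p ^ e : ℕ) ^ n - 1 - u * ((-1) ^ n * (p ^ e : ℕ) ^ n))) := by
            exact_mod_cast hX
          rw [hER, hFR, hPnt, ← hR] at hXR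
          push_cast at hXR
          field_simp
          linear_combination hXR
  obtain ⟨i₀, hi₀, hi⟩ : ∃ i₀ < l * u, m / (d * t) * i₀ ≡ h / d [MOD (l * u)] := by
    obtain ⟨i₀, hi₀, hi⟩ := exists_mul_modEq (t₀ := m / t) (l := d) (u := l * u)
      (by rw [← hsd, ← hd]) hd0 hlu0 ((h / d : ℕ) : ℤ)
    exact ⟨i₀, hi₀, by rw [hdiv]; exact_mod_cast hi⟩
  refine ⟨key, fun ha hl1 => ?_, fun ha hds' => ?_⟩
  · rw [((key i₀ hi₀ hi).1 ha).2 (Or.inl hl1), hl1]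
    simp
  -- Here l = u = 1, so both divisibility and the congruence for j₀ = 0 are automatic, and the
  -- correction term of the last case vanishes.
  · have hlu1 : l * u = 1 := by rw [← hS, hds', Nat.div_self hs0]
    obtain ⟨hl1, hu1⟩ := mul_eq_one.1 hlu1
    obtain ⟨ι, hι⟩ := (mem_powers_iff_mem_zpowers).2 (hγE (Units.mk0
      (algebraMap F E (-((m / t : ℕ) : F) / a))
      (by rw [Ne, map_eq_zero]; exact div_ne_zero (neg_ne_zero.2 hmtF) ha)))
    have hι' : ((unitNorm E γ ^ ι : Eˣ) : E) = algebraMap F E (-((m / t : ℕ) : F) / a) :=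
      congrArg Units.val hι
    have hD : (l : ℤ) ∣ (kConst p e n t (l * u) : ℤ) - i₀ - ι := by rw [hl1]; simp
    rw [(((key i₀ hi₀ hi).2 ha ι hι').2 hD 0 hu0 (by rw [hu1]; simp [Int.modEq_one])).2
      (Or.inl hu1), hds', hl1, hu1]
    have : (s : ℝ) ≠ 0 := by exact_mod_cast hs0.ne'
    field_simp
    simp
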